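/- Let $\Gamma^*_4\subset\mathbf{R}^{15}$ be the set of all vectors $(H(S))_{\emptyset\ne S\subseteq\{A,B,C,D\}}$ of joint Shannon entropies (in bits) of four jointly distributed discrete random variables $A,B,C,D$ with finite entropies, and let $\bar\Gamma^*_4$ be its closure. For $x=(H(S))_S\in\mathbf{R}^{15}$ put $H(\emptyset)=0$ and $I(S;T|U)=H(S\cup U)+H(T\cup U)-H(U)-H(S\cup T\cup U)$, $I(S;T)=I(S;T|\emptyset)$. Let $\Gamma_4\subset\mathbf{R}^{15}$ be the cone defined by the Shannon inequalities $I(S;T|U)\ge 0$ for all $S,T,U\subseteq\{A,B,C,D\}$, and let $I_4\subseteq\Gamma_4$ be the subset of points that also satisfy the Ingleton inequality $I(A;B)\le I(A;B|C)+I(A;B|D)+I(C;D)$ and all inequalities obtained from it by permuting $A,B,C,D$. Normalize each of $\bar\Gamma^*_4$, $\Gamma_4$, $I_4$ by intersecting it with the hyperplane $H(ABCD)=1$, and regard the results (with the same names) as subsets of $\mathbf{R}^{14}$ by dropping the coordinate $H(ABCD)$. For a polytope $P\subset\mathbf{R}^n$, an extreme segment of $P$ is a set of the form $\{x\in P: L(x)=0\}$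 with $L$ an affine function that is nonnegative on $P$; the $m$-skeleton of $P$ is the union of its $m$-dimensional extreme segments (for $m=1$: of its edges); and for $S\subseteq P$ the $m$-core of $S$ in $P$ is the convex hull of the intersection of $S$ with the $m$-skeleton of $P$. Theorem. The $1$-core of the normalized $\bar\Gamma^*_4$ in the normalized $\Gamma_4$ is equal to the normalized $I_4$. -/

import Mathlib

/-! Geometry of the entropy region of four random variables. The four variables `A, B, C, D` are
indexed by `0, 1, 2, 3 : Fin 4`, and collections of variables are finsets of `Fin 4`. -/

/-- The space `ℝ¹⁵`: one coordinate for each nonempty collection of the four variables. -/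
abbrev EntropySpace15 : Type := {S : Finset (Fin 4) // S.Nonempty} → ℝ

/-- The space `ℝ¹⁴`: one coordinate for each nonempty proper collection of the four variables. -/
abbrev EntropySpace14 : Type := {S : Finset (Fin 4) // S.Nonempty ∧ S ≠ Finset.univ} → ℝ

/-- The joint distribution of the subcollection `S` of jointly distributed discrete random
variables with joint distribution `p`; the `i`-th variable takes values in `α i`. -/
noncomputable def marginal {α : Fin 4 → Type} (p : PMF (∀ i, α i)) (S : Finset (Fin 4)) :
    PMF (∀ i : S, α i) :=
  p.map (fun a i => a i)

/-- The discrete distribution `q` has finite Shannon entropy (in bits), equal to `h`. -/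
def HasEntropy {β : Type} (q : PMF β) (h : ℝ) : Prop :=
  HasSum (fun b => -((q b).toReal * Real.logb 2 (q b).toReal)) h

/-- The entropy region `Γ*₄` in `ℝ¹⁵`: all vectors of joint entropies of four jointly distributed
discrete random variables (with finite entropies). -/
def entropyRegion : Set EntropySpace15 :=
  {x | ∃ (α : Fin 4 → Type) (p : PMF (∀ i, α i)),
    ∀ S : {S : Finset (Fin 4) // S.Nonempty}, HasEntropy (marginal p S.1) (x S)}

/-- The formal joint entropy `H(S)` of a vector of `ℝ¹⁵`, with `H(∅) = 0`. -/
def formalH (x : EntropySpace15) (S : Finset (Fin 4)) : ℝ :=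
  if hS : S.Nonempty then x ⟨S, hS⟩ else 0

/-- The formal conditional mutual information `I(S;T|U)` of a vector of `ℝ¹⁵`. -/
def formalI (x : EntropySpace15) (S T U : Finset (Fin 4)) : ℝ :=
  formalH x (S ∪ U) + formalH x (T ∪ U) - formalH x U - formalH x (S ∪ T ∪ U)

/-- The Shannon cone `Γ₄` in `ℝ¹⁵`, defined by all Shannon inequalities `I(S;T|U) ≥ 0`. -/
def shannonCone : Set EntropySpace15 :=
  {x | ∀ S T U : Finset (Fin 4), 0 ≤ formalI x S T U}

/-- The Ingleton cone in `ℝ¹⁵`: the part of the Shannon cone satisfying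
`I(A;B) ≤ I(A;B|C) + I(A;B|D) + I(C;D)` and its images under permuting the variables. -/
def ingletonCone : Set EntropySpace15 :=
  {x | x ∈ shannonCone ∧ ∀ σ : Equiv.Perm (Fin 4),
    formalI x {σ 0} {σ 1} ∅ ≤
      formalI x {σ 0} {σ 1} {σ 2} + formalI x {σ 0} {σ 1} {σ 3} + formalI x {σ 2} {σ 3} ∅}

/-- The embedding of `ℝ¹⁴` in `ℝ¹⁵` as the hyperplane `H(ABCD) = 1`. -/
def withTotalOne (y : EntropySpace14) : EntropySpace15 :=
  fun S => if h : S.1 = Finset.univ then 1 else y ⟨S.1, S.2, h⟩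

/-- The cross-section of a subset of `ℝ¹⁵` by the hyperplane `H(ABCD) = 1`, as a subset
of `ℝ¹⁴`. -/
def normalized (C : Set EntropySpace15) : Set EntropySpace14 :=
  {y | withTotalOne y ∈ C}

/-- `F` is an extreme segment (an exposed face) of `P`: the zero set in `P` of an affine function
that is nonnegative on `P`. -/
def IsExtremeSegment {E : Type*} [AddCommGroup E] [Module ℝ E] (P F : Set E) : Prop :=
  ∃ L : E →ᵃ[ℝ] ℝ, (∀ x ∈ P, 0 ≤ L x) ∧ F = {x | x ∈ P ∧ L x = 0}

/-- The `m`-skeleton of `P`: the union of its `m`-dimensional extreme segments, the dimension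
being that of the affine span. -/
def skeleton {E : Type*} [AddCommGroup E] [Module ℝ E] (m : ℕ) (P : Set E) : Set E :=
  {x | ∃ F : Set E, IsExtremeSegment P F ∧
    Module.finrank ℝ (affineSpan ℝ F).direction = m ∧ x ∈ F}

/-- The `m`-core of `S` in `P`: the convex hull of the intersection of `S` with the `m`-skeleton
of `P`. -/
def core {E : Type*} [AddCommGroup E] [Module ℝ E] (m : ℕ) (S P : Set E) : Set E :=
  convexHull ℝ (S ∩ skeleton m P)

/-! Both inclusions combine finite facts about polyhedral cones with two facts about entropy.

The cone $I_4$ is spanned by the 35 rank functions in `ingletonRays`, so it suffices to place their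
normalized points in the core. Each is the rank function of a linear code over $\mathbf Z/2$ or
$\mathbf Z/3$ (up to scale), and sending a long block of the code with small probability brings
every positive multiple into the closure of the entropy region
(`withTotalOne_rayPoint_mem_closure`). Each point also lies on an edge of $\Gamma_4$
(`rayPoint_mem_skeleton_of_mem`).

Conversely $I_4$ is convex, so it suffices that a point $y$ of $\bar\Gamma^*_4$ on an edge of
$\Gamma_4$ satisfies Ingleton (`mem_ingletonCone_of_mem_skeleton`). By the Zhang–Yeung inequality
(`zhang_yeung`), the Ingleton expression plus $I(A;B|C)+I(A;C|B)+I(B;C|A)$ is nonnegative, and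
likewise with $D$ in place of $C$. If Ingleton fails at $y$, then some information $f$ within $ABC$
and some $g$ within $ABD$ are positive at $y$. But the part of $\Gamma_4$ that violates this
Ingleton inequality lies in the cone spanned by one apex, `vamosRay`, where all these informations
vanish, and by rays on the Ingleton hyperplane, none of which has both $f$ and $g$ positive. So $y$
mixes the apex with a ray where $f>0$ and another where $g>0$. These three points are not collinear,
as they would have to be on an edge.

The statements that given rays span a cone are checked by computation. If the support (the set of
nonvanishing defining functionals) of every nonzero vector contains the support of a ray, then rays
can be subtracted until nothing is left (`inCone_of_supp`). Linear relations among the functionals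
constrain supports by propositional clauses, and `refute` shows that no support avoids all rays. -/

/-! ### A satisfiability checker evaluated by the kernel -/

/-- `force n k = k n`, with `n` brought to a literal before `k` is unfolded. -/
def force {α : Type} (n : ℕ) (k : ℕ → α) : α :=
  Nat.rec (k 0) (fun m _ => k (Nat.succ m)) n

theorem force_eq {α : Type} (n : ℕ) (k : ℕ → α) : force n k = k n := by
  cases n <;> rfl

/-- A clause is a pair of bit masks: the variables that occur positively, and those that occur
negatively. -/
def ClauseHolds (s : ℕ → Prop) (c : ℕ × ℕ) : Prop :=
  (∃ i, c.1.testBit i = true ∧ s i) ∨ ∃ i, c.2.testBit i = true ∧ ¬ s i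

/-- Simplify clauses after setting the variables in the mask `m` to true. -/
def setTrue (m : ℕ) (C : List (ℕ × ℕ)) : List (ℕ × ℕ) :=
  List.rec [] (fun c _ ih =>
    bif Nat.beq (Nat.land c.1 m) 0 then
      force (Nat.xor c.2 (Nat.land c.2 m)) fun n => (c.1, n) :: ih
    else ih) C

/-- Simplify clauses after setting the variables in the mask `m` to false. -/
def setFalse (m : ℕ) (C : List (ℕ × ℕ)) : List (ℕ × ℕ) :=
  List.rec [] (fun c _ ih =>
    bif Nat.beq (Nat.land c.2 m) 0 then
      force (Nat.xor c.1 (Nat.land c.1 m)) fun p => (p, c.2) :: ih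
    else ih) C

/-- The number of set bits, capped at 3. -/
def bitScore (x : ℕ) : ℕ :=
  bif Nat.beq x 0 then 0 else
  force (Nat.land x (Nat.pred x)) fun x₁ =>
  bif Nat.beq x₁ 0 then 1 else
  bif Nat.beq (Nat.land x₁ (Nat.pred x₁)) 0 then 2 else 3

/-- The variables of a shortest clause, given the best score and clause found so far. -/
def pick (C : List (ℕ × ℕ)) : ℕ → ℕ → ℕ :=
  List.rec (fun _ x => x) (fun c _ ih s x =>
    force (Nat.lor c.1 c.2) fun y => force (bitScore y) fun t =>
    bif Nat.beq t 0 then 0 else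
    bif Nat.ble s t then ih s x else ih t y) C

/-- Whether some clause is empty. -/
def hasEmpty (C : List (ℕ × ℕ)) : Bool :=
  List.rec false (fun c _ ih => bif Nat.beq (Nat.lor c.1 c.2) 0 then true else ih) C

/-- Refute a set of clauses by branching, with at most the given number of nested decisions. The
definitions here use recursors directly, as these evaluate faster in the kernel. -/
def refute (fuel : ℕ) : List (ℕ × ℕ) → Bool :=
  Nat.rec (fun _ => false) (fun _ ih C =>
    -- Scores are at most 3, so the initial score 4 loses to any clause. The result 0 arises both
    -- from an empty list and from an empty clause; only the latter is a refutation.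
    force (pick C 4 0) fun x =>
    bif Nat.beq x 0 then hasEmpty C else
    force (Nat.pow 2 (Nat.log2 x)) fun m =>
    ih (setTrue m C) && ih (setFalse m C)) fuel

theorem hasEmpty_sound {s : ℕ → Prop} {C : List (ℕ × ℕ)} (h : hasEmpty C = true) :
    ¬ ∀ c ∈ C, ClauseHolds s c := by
  induction C with
  | nil => cases h
  | cons c C ih =>
    intro hC
    change (bif Nat.beq (Nat.lor c.1 c.2) 0 then true else hasEmpty C) = true at h
    rcases hpn : Nat.beq (Nat.lor c.1 c.2) 0 with _ | _
    · rw [hpn, cond_false] at h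
      exact ih h fun c hc => hC c (List.mem_cons_of_mem _ hc)
    · have h0 : c.1 ||| c.2 = 0 := Nat.eq_of_beq_eq_true hpn
      have hp : c.1 = 0 ∧ c.2 = 0 := by simpa using h0
      have := hC c List.mem_cons_self
      simp [ClauseHolds, hp.1, hp.2] at this

theorem setTrue_sound {s : ℕ → Prop} {v : ℕ} (hv : s v) {C : List (ℕ × ℕ)}
    (h : ∀ c ∈ C, ClauseHolds s c) : ∀ c ∈ setTrue (2 ^ v) C, ClauseHolds s c := by
  induction C with
  | nil => intro c hc; cases hc
  | cons d C ih =>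
    intro c hc
    have ih := ih fun c hc => h c (List.mem_cons_of_mem _ hc)
    change c ∈ (bif Nat.beq (Nat.land d.1 (2 ^ v)) 0 then
      force (Nat.xor d.2 (Nat.land d.2 (2 ^ v))) fun n => (d.1, n) :: setTrue (2 ^ v) C
      else setTrue (2 ^ v) C) at hc
    rw [force_eq] at hc
    rcases hpn : Nat.beq (Nat.land d.1 (2 ^ v)) 0 with _ | _
    · rw [hpn, cond_false] at hc
      exact ih c hc
    · rw [hpn, cond_true, List.mem_cons] at hc
      rcases hc with rfl | hc
      · rcases h d List.mem_cons_self with h1 | ⟨i, hi, hs⟩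
        · exact Or.inl h1
        · refine Or.inr ⟨i, ?_, hs⟩
          have hiv : v ≠ i := by rintro rfl; exact hs hv
          change (d.2 ^^^ (d.2 &&& 2 ^ v)).testBit i = true
          simpa [Nat.testBit_two_pow, hiv] using hi
      · exact ih c hc

theorem setFalse_sound {s : ℕ → Prop} {v : ℕ} (hv : ¬ s v) {C : List (ℕ × ℕ)}
    (h : ∀ c ∈ C, ClauseHolds s c) : ∀ c ∈ setFalse (2 ^ v) C, ClauseHolds s c := by
  induction C with
  | nil => intro c hc; cases hc
  | cons d C ih =>
    intro c hc
    have ih := ih fun c hc => h c (List.mem_cons_of_mem _ hc)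
    change c ∈ (bif Nat.beq (Nat.land d.2 (2 ^ v)) 0 then
      force (Nat.xor d.1 (Nat.land d.1 (2 ^ v))) fun p => (p, d.2) :: setFalse (2 ^ v) C
      else setFalse (2 ^ v) C) at hc
    rw [force_eq] at hc
    rcases hpn : Nat.beq (Nat.land d.2 (2 ^ v)) 0 with _ | _
    · rw [hpn, cond_false] at hc
      exact ih c hc
    · rw [hpn, cond_true, List.mem_cons] at hc
      rcases hc with rfl | hc
      · rcases h d List.mem_cons_self with ⟨i, hi, hs⟩ | h1
        · refine Or.inl ⟨i, ?_, hs⟩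
          have hiv : v ≠ i := by rintro rfl; exact hv hs
          change (d.1 ^^^ (d.1 &&& 2 ^ v)).testBit i = true
          simpa [Nat.testBit_two_pow, hiv] using hi
        · exact Or.inr h1
      · exact ih c hc

/-- The branching heuristic plays no role: whichever variable is chosen, one of the two branches
agrees with `s`. -/
theorem refute_sound {s : ℕ → Prop} {fuel : ℕ} {C : List (ℕ × ℕ)} (h : refute fuel C = true) :
    ¬ ∀ c ∈ C, ClauseHolds s c := by
  induction fuel generalizing C with
  | zero => cases h
  | succ fuel ih =>
    intro hC
    change (force (pick C 4 0) fun x => bif Nat.beq x 0 then hasEmpty C else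
      force (Nat.pow 2 (Nat.log2 x)) fun m =>
      refute fuel (setTrue m C) && refute fuel (setFalse m C)) = true at h
    rw [force_eq, force_eq] at h
    rcases hx : Nat.beq (pick C 4 0) 0 with _ | _
    · rw [hx, cond_false, Bool.and_eq_true] at h
      by_cases hv : s (Nat.log2 (pick C 4 0))
      · exact ih h.1 (setTrue_sound hv hC)
      · exact ih h.2 (setFalse_sound hv hC)
    · rw [hx, cond_true] at h
      exact hasEmpty_sound h hC

/-! ### Functionals, relations and rays -/

/-- The value of the linear functional `f`, a list of coefficients and masks, at `h`. -/
def ev {R : Type} [Ring R] : List (ℤ × ℕ) → (ℕ → R) → R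
  | [], _ => 0
  | t :: f, h => t.1 * h t.2 + ev f h

/-- The functional `H(a ∪ k) + H(b ∪ k) - H(k) - H(a ∪ b ∪ k)`. -/
def infoFn (a b k : ℕ) : List (ℤ × ℕ) :=
  [(1, a ||| k), (1, b ||| k), (-1, k), (-1, a ||| b ||| k)]

/-- The partitions of the four variables into two pairs, as bit masks. -/
def quads : List (ℕ × ℕ × ℕ × ℕ) :=
  [(1, 2, 4, 8), (1, 4, 2, 8), (1, 8, 2, 4), (2, 4, 1, 8), (2, 8, 1, 4), (4, 8, 1, 2)]

/-- The elemental Shannon functionals. -/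
def shannonFns : List (List (ℤ × ℕ)) :=
  [infoFn 1 1 14, infoFn 2 2 13, infoFn 4 4 11, infoFn 8 8 7] ++
  quads.flatMap fun q => [infoFn q.1 q.2.1 0, infoFn q.1 q.2.1 q.2.2.1, infoFn q.1 q.2.1 q.2.2.2,
    infoFn q.1 q.2.1 (q.2.2.1 ||| q.2.2.2)]

/-- The Ingleton functional. -/
def ingFn (q : ℕ × ℕ × ℕ × ℕ) : List (ℤ × ℕ) :=
  infoFn q.1 q.2.1 q.2.2.1 ++ infoFn q.1 q.2.1 q.2.2.2 ++ infoFn q.2.2.1 q.2.2.2 0 ++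
    (infoFn q.1 q.2.1 0).map fun t => (-t.1, t.2)

/-- Linear relations among the functionals `shannonFns ++ quads.map ingFn`: the sum of the
functionals with an index in the first list is the sum of those with an index in the second. -/
def fnRels : List (List ℕ × List ℕ) :=
  [([4,9],[5,8]), ([4,17],[5,16]), ([4,13],[6,12]), ([4,21],[6,20]), ([6,11],[7,10]),
   ([5,15],[7,14]), ([6,19],[7,18]), ([5,23],[7,22]), ([8,17],[9,16]), ([8,14],[10,12]),
   ([8,25],[10,24]), ([9,15],[11,13]), ([10,19],[11,18]), ([9,27],[11,26]), ([12,21],[13,20]),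
   ([12,25],[14,24]), ([14,23],[15,22]), ([13,27],[15,26]), ([16,22],[18,20]), ([16,26],[18,24]),
   ([17,23],[19,21]), ([17,27],[19,25]), ([20,26],[22,24]), ([21,27],[23,25]),
   ([8,33],[4,10,26]), ([12,33],[4,14,26]), ([16,33],[4,18,25]), ([20,33],[4,22,25]),
   ([24,33],[4,25,26]), ([4,28],[5,6,24]), ([7,33],[5,6,27]), ([4,29],[5,10,20]),
   ([6,29],[5,10,21]), ([9,33],[5,10,26]), ([11,33],[5,10,27]), ([7,29],[5,11,21]),
   ([4,31],[5,12,18]), ([6,31],[5,13,18]), ([7,31],[5,13,19]), ([12,28],[5,13,24]),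
   ([14,28],[5,13,25]), ([17,33],[5,18,25]), ([19,33],[5,18,27]), ([20,28],[5,21,24]),
   ([22,28],[5,21,26]), ([4,32],[6,8,22]), ([5,32],[6,9,22]), ([7,32],[6,9,23]),
   ([8,28],[6,9,24]), ([10,28],[6,9,25]), ([4,30],[6,14,16]), ([5,30],[6,14,17]),
   ([13,33],[6,14,26]), ([15,33],[6,14,27]), ([7,30],[6,15,17]), ([16,28],[6,17,24]),
   ([18,28],[6,17,26]), ([21,33],[6,22,25]), ([23,33],[6,22,27]), ([11,28],[7,9,25]),
   ([15,28],[7,13,25]), ([19,28],[7,17,26]), ([23,28],[7,21,26]), ([27,28],[7,25,26]),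
   ([12,32],[8,13,22]), ([16,32],[8,18,21]), ([20,32],[8,21,22]), ([24,32],[8,21,26]),
   ([8,29],[9,10,20]), ([11,32],[9,10,23]), ([8,31],[9,12,18]), ([10,31],[9,14,18]),
   ([11,31],[9,14,19]), ([12,29],[9,14,20]), ([13,29],[9,14,21]), ([17,32],[9,18,21]),
   ([19,32],[9,18,23]), ([24,29],[9,20,25]), ([26,29],[9,22,25]), ([8,30],[10,13,16]),
   ([9,30],[10,13,17]), ([14,32],[10,13,22]), ([15,32],[10,13,23]), ([11,30],[10,15,17]),
   ([16,29],[10,17,20]), ([18,29],[10,17,22]), ([25,32],[10,21,26]), ([27,32],[10,23,26]),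
   ([15,29],[11,14,21]), ([19,29],[11,17,22]), ([23,29],[11,21,22]), ([27,29],[11,22,25]),
   ([16,31],[12,17,18]), ([20,31],[12,17,22]), ([24,31],[12,17,26]), ([12,30],[13,14,16]),
   ([15,31],[13,14,19]), ([24,30],[13,16,25]), ([21,31],[13,17,22]), ([26,30],[13,18,25]),
   ([23,31],[13,19,22]), ([20,30],[14,16,21]), ([25,31],[14,17,26]), ([22,30],[14,18,21]),
   ([27,31],[14,19,26]), ([19,30],[15,17,18]), ([23,30],[15,18,21]), ([27,30],[15,18,25])]

/-- The number of variables in the collection with mask `S`. -/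
def pc (S : ℕ) : ℕ := Nat.land S 1 + Nat.land (S / 2) 1 + Nat.land (S / 4) 1 + Nat.land (S / 8) 1

/-- The rank functions that span the extreme rays of the Ingleton cone. -/
def ingletonRays : List (ℕ → ℕ) :=
  (List.range' 1 15).map (fun J S => min 1 (pc (S &&& J))) ++
  [7, 11, 13, 14, 15].map (fun J S => min 2 (pc (S &&& J))) ++
  [fun S => min 3 (pc S)] ++
  quads.map (fun q S => min 2 (min 1 (pc (S &&& (q.1 ||| q.2.1))) + pc (S &&& (q.2.2.1 ||| q.2.2.2)))) ++
  [1, 2, 4, 8].flatMap fun a => [fun S => min 2 (pc S + pc (S &&& a)),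
    fun S => min 3 (pc S + pc (S &&& a))]

/-! ### Conic hulls certified by supports -/

/-- The supporting functionals of the rank function `r`, as a bit mask. -/
def suppMask (r : ℕ → ℕ) : List (List (ℤ × ℕ)) → ℕ
  | [] => 0
  | f :: fs => force (suppMask r fs) fun m =>
    bif ev f (fun S => (r S : ℤ)) == 0 then 2 * m else 2 * m + 1

/-- The bit mask of a list of positions. -/
def listMask : List ℕ → ℕ
  | [] => 0
  | i :: l => 2 ^ i ||| listMask l

/-- The clauses that hold for the supports of nonnegative vectors satisfying the relations. -/
def relClauses : List (List ℕ × List ℕ) → List (ℕ × ℕ)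
  | [] => []
  | (A, B) :: rels => force (listMask A) fun a => force (listMask B) fun b =>
    A.map (fun i => (b, 2 ^ i)) ++ (B.map (fun i => (a, 2 ^ i)) ++ relClauses rels)

/-- The clauses saying that no ray is supported in the given support. -/
def rayClauses (fs : List (List (ℤ × ℕ))) : List (ℕ → ℕ) → List (ℕ × ℕ)
  | [] => []
  | r :: rays => force (suppMask r fs) fun m => (0, m) :: rayClauses fs rays

/-- The sum of the functionals with the given indices. -/
def sumFn (fs : List (List (ℤ × ℕ))) (A : List ℕ) : List (ℤ × ℕ) :=
  A.flatMap fun i => fs.getD i []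

/-- The coefficient of the functional `f` at `m`. -/
def coeff (f : List (ℤ × ℕ)) (m : ℕ) : ℤ := ev f fun k => bif Nat.beq k m then 1 else 0

/-- Whether the relation holds for all vectors. -/
def relValid (fs : List (List (ℤ × ℕ))) (rel : List ℕ × List ℕ) : Bool :=
  (List.range' 1 15).all fun m => coeff (sumFn fs rel.1) m == coeff (sumFn fs rel.2) m

/-- Whether the functionals are nonnegative on the rank function `r`, and not all zero. -/
def rayValid (fs : List (List (ℤ × ℕ))) (r : ℕ → ℕ) : Bool :=
  r 0 == 0 && suppMask r fs != 0 && fs.all fun f => decide (0 ≤ ev f fun S => (r S : ℤ))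

/-- A certificate that the vectors on which the functionals `fs` are nonnegative and those with an
index in `Z` vanish lie in the conic hull of `rays`. -/
def coneCert (fs : List (List (ℤ × ℕ))) (rels : List (List ℕ × List ℕ)) (rays : List (ℕ → ℕ))
    (Z : List ℕ) : Bool :=
  fs.all (fun f => f.all fun t => t.2 < 16) && rels.all (relValid fs) && rays.all (rayValid fs) &&
  -- The final clause says that some functional does not vanish. A decision removes its variable
  -- from all clauses and at most 34 variables occur in the certificates used, so 60 nested
  -- decisions are more than enough.
  refute 60 (relClauses rels ++ (rayClauses fs rays ++
    (Z.map (fun i => (0, 2 ^ i)) ++ [(2 ^ fs.length - 1, 0)])))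

section ev
variable {R : Type} [Ring R]

theorem ev_append (f g : List (ℤ × ℕ)) (h : ℕ → R) : ev (f ++ g) h = ev f h + ev g h := by
  induction f with
  | nil => simp [ev]
  | cons t f ih => simp [ev, ih, add_assoc]

theorem ev_sub_smul (f : List (ℤ × ℕ)) (h r : ℕ → ℝ) (t : ℝ) :
    ev f (fun m => h m - t * r m) = ev f h - t * ev f r := by
  induction f with
  | nil => simp [ev]
  | cons a f ih => simp only [ev, ih]; ring

theorem ev_sum {ι : Type} (s : Finset ι) (f : List (ℤ × ℕ)) (c : ι → ℝ) (r : ι → ℕ → ℝ) :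
    ev f (fun m => ∑ i ∈ s, c i * r i m) = ∑ i ∈ s, c i * ev f (r i) := by
  induction f with
  | nil => simp [ev]
  | cons a f ih =>
    simp only [ev, ih, mul_add, Finset.sum_add_distrib, Finset.mul_sum]
    congr 1
    exact Finset.sum_congr rfl fun i _ => by ring

theorem ev_cast (f : List (ℤ × ℕ)) (r : ℕ → ℕ) :
    ev f (fun m => (r m : ℝ)) = ((ev f fun m => (r m : ℤ) : ℤ) : ℝ) := by
  induction f with
  | nil => simp [ev]
  | cons a f ih => simp [ev, ih]

theorem ev_congr {f : List (ℤ × ℕ)} (hf : ∀ t ∈ f, t.2 < 16) {h g : ℕ → R}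
    (hhg : ∀ m < 16, h m = g m) : ev f h = ev f g := by
  induction f with
  | nil => rfl
  | cons a f ih =>
    simp only [ev]
    rw [hhg _ (hf a List.mem_cons_self), ih fun t ht => hf t (List.mem_cons_of_mem _ ht)]

theorem ev_eq_sum_coeff {f : List (ℤ × ℕ)} (hf : ∀ t ∈ f, t.2 < 16) (h : ℕ → R) :
    ev f h = ∑ m ∈ Finset.range 16, (coeff f m : R) * h m := by
  induction f with
  | nil => simp [ev, coeff]
  | cons a f ih =>
    have ih := ih fun t ht => hf t (List.mem_cons_of_mem _ ht)
    have ha : a.2 ∈ Finset.range 16 := Finset.mem_range.2 (hf a List.mem_cons_self)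
    have h1 (m : ℕ) : (coeff (a :: f) m : R) * h m
        = (if a.2 = m then (a.1 : R) * h m else 0) + coeff f m * h m := by
      have : coeff (a :: f) m = (if a.2 = m then a.1 else 0) + coeff f m := by
        simp only [coeff, ev]
        rcases eq_or_ne a.2 m with h | h
        · simp [h]
        · have : Nat.beq a.2 m = false := by
            rw [← Bool.not_eq_true, Nat.beq_eq]; exact h
          simp [h, this]
      rw [this]
      split_ifs <;> simp [add_mul]
    simp only [h1, Finset.sum_add_distrib, ← ih, Finset.sum_ite_eq, ha, if_true, ev]

end ev

theorem sumFn_lt {fs : List (List (ℤ × ℕ))} (hfs : ∀ f ∈ fs, ∀ t ∈ f, t.2 < 16) (A : List ℕ) :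
    ∀ t ∈ sumFn fs A, t.2 < 16 := by
  intro t ht
  obtain ⟨i, -, hi⟩ := List.mem_flatMap.1 ht
  rcases lt_or_ge i fs.length with h | h
  · rw [List.getD_eq_getElem _ _ h] at hi
    exact hfs _ (List.getElem_mem h) t hi
  · rw [List.getD_eq_default _ _ h] at hi
    cases hi

theorem ev_sumFn (fs : List (List (ℤ × ℕ))) (A : List ℕ) (h : ℕ → ℝ) :
    ev (sumFn fs A) h = (A.map fun i => ev (fs.getD i []) h).sum := by
  induction A with
  | nil => simp [sumFn, ev]
  | cons i A ih =>
    rw [List.map_cons, List.sum_cons, ← ih, ← ev_append]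
    rfl

/-- The check skips the coefficient at the empty collection, which is harmless because `y 0 = 0`. -/
theorem relValid_sound {fs : List (List (ℤ × ℕ))} (hfs : ∀ f ∈ fs, ∀ t ∈ f, t.2 < 16)
    {rel : List ℕ × List ℕ} (h : relValid fs rel = true) {y : ℕ → ℝ} (y0 : y 0 = 0) :
    (rel.1.map fun i => ev (fs.getD i []) y).sum = (rel.2.map fun i => ev (fs.getD i []) y).sum := by
  rw [← ev_sumFn, ← ev_sumFn, ev_eq_sum_coeff (sumFn_lt hfs _), ev_eq_sum_coeff (sumFn_lt hfs _)]
  refine Finset.sum_congr rfl fun m hm => ?_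
  rcases Nat.eq_zero_or_pos m with rfl | hm0
  · simp [y0]
  · have := List.all_eq_true.1 h m (List.mem_range'_1.2 ⟨hm0, by
      have := Finset.mem_range.1 hm; omega⟩)
    rw [beq_iff_eq.1 this]

theorem testBit_listMask {l : List ℕ} {i : ℕ} : (listMask l).testBit i = true ↔ i ∈ l := by
  induction l with
  | nil => simp [listMask]
  | cons j l ih =>
    rw [listMask, Nat.testBit_or, Bool.or_eq_true, ih, Nat.testBit_two_pow, decide_eq_true_eq,
      List.mem_cons, eq_comm]

theorem testBit_suppMask {r : ℕ → ℕ} {fs : List (List (ℤ × ℕ))} {i : ℕ} :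
    (suppMask r fs).testBit i = true ↔ ev (fs.getD i []) (fun S => (r S : ℤ)) ≠ 0 := by
  induction fs generalizing i with
  | nil => simp [suppMask, ev]
  | cons f fs ih =>
    rw [suppMask, force_eq]
    rcases hf : (ev f (fun S => (r S : ℤ)) == 0) with _ | _
    · rw [cond_false]
      cases i with
      | zero => simpa using hf
      | succ i =>
        rw [List.getD_cons_succ, ← ih, Nat.testBit_succ]
        rw [show (2 * suppMask r fs + 1) / 2 = suppMask r fs by omega]
    · rw [cond_true]
      cases i with
      | zero => simpa using hf
      | succ i =>
        rw [List.getD_cons_succ, ← ih, Nat.testBit_succ]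
        rw [show (2 * suppMask r fs) / 2 = suppMask r fs by omega]

theorem relClauses_sound {s : ℕ → Prop} {rels : List (List ℕ × List ℕ)}
    (h : ∀ rel ∈ rels, (∃ i ∈ rel.1, s i) ↔ ∃ i ∈ rel.2, s i) :
    ∀ c ∈ relClauses rels, ClauseHolds s c := by
  induction rels with
  | nil => intro c hc; cases hc
  | cons rel rels ih =>
    obtain ⟨A, B⟩ := rel
    intro c hc
    rw [relClauses, force_eq, force_eq, List.mem_append, List.mem_append] at hc
    have key : ∀ A B : List ℕ, ((∃ i ∈ A, s i) → ∃ i ∈ B, s i) →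
        c ∈ A.map (fun i => (listMask B, 2 ^ i)) → ClauseHolds s c := by
      intro A B hAB hc
      obtain ⟨i, hi, rfl⟩ := List.mem_map.1 hc
      by_cases hs : s i
      · obtain ⟨j, hj, hsj⟩ := hAB ⟨i, hi, hs⟩
        exact Or.inl ⟨j, testBit_listMask.2 hj, hsj⟩
      · exact Or.inr ⟨i, by simp, hs⟩
    rcases hc with hc | hc | hc
    · exact key A B (h _ List.mem_cons_self).1 hc
    · exact key B A (h _ List.mem_cons_self).2 hc
    · exact ih (fun rel hrel => h rel (List.mem_cons_of_mem _ hrel)) c hc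

theorem mem_rayClauses {fs : List (List (ℤ × ℕ))} {rays : List (ℕ → ℕ)} {c : ℕ × ℕ}
    (hc : c ∈ rayClauses fs rays) : ∃ r ∈ rays, c = (0, suppMask r fs) := by
  induction rays with
  | nil => cases hc
  | cons r rays ih =>
    rw [rayClauses, force_eq, List.mem_cons] at hc
    rcases hc with rfl | hc
    · exact ⟨r, List.mem_cons_self, rfl⟩
    · obtain ⟨r', hr', h⟩ := ih hc
      exact ⟨r', List.mem_cons_of_mem _ hr', h⟩

/-- `h` agrees on the 16 masks with a conic combination of `rays`. -/
def InCone (rays : List (ℕ → ℕ)) (h : ℕ → ℝ) : Prop :=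
  ∃ c : Fin rays.length → ℝ, (∀ i, 0 ≤ c i) ∧ ∀ m < 16, h m = ∑ i, c i * (rays.get i m : ℝ)

/-- If every nonzero vector of a cone has a ray supported in its support, then the rays span the
cone. -/
theorem inCone_of_supp {fs : List (List (ℤ × ℕ))} {rays : List (ℕ → ℕ)}
    (hpt : ∀ y : ℕ → ℝ, y 0 = 0 → (∀ f ∈ fs, ev f y = 0) → ∀ m < 16, y m = 0)
    {Z : List (ℤ × ℕ) → Prop}
    (H : ∀ y : ℕ → ℝ, y 0 = 0 → (∀ f ∈ fs, 0 ≤ ev f y) → (∀ f ∈ fs, Z f → ev f y = 0) →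
      (∃ f ∈ fs, ev f y ≠ 0) → ∃ r ∈ rays, r 0 = 0 ∧ (∃ f ∈ fs, ev f (fun m => (r m : ℝ)) ≠ 0) ∧
        ∀ f ∈ fs, 0 ≤ ev f (fun m => (r m : ℝ)) ∧ (ev f y = 0 → ev f (fun m => (r m : ℝ)) = 0))
    {h : ℕ → ℝ} (h0 : h 0 = 0) (hnn : ∀ f ∈ fs, 0 ≤ ev f h) (hZ : ∀ f ∈ fs, Z f → ev f h = 0) :
    InCone rays h := by
  classical
  induction hn : (fs.toFinset.filter fun f => ev f h ≠ 0).card using Nat.strong_induction_on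
    generalizing h with
  | _ n ih =>
  by_cases hex : ∃ f ∈ fs, ev f h ≠ 0
  swap
  · push Not at hex
    exact ⟨0, fun _ => le_rfl, fun m hm => by simp [hpt h h0 hex m hm]⟩
  obtain ⟨r, hr, r0, ⟨f₁, hf₁, hrf₁⟩, hr'⟩ := H h h0 hnn hZ hex
  set ρ : ℕ → ℝ := fun m => (r m : ℝ) with hρ
  have hS : (fs.toFinset.filter fun f => 0 < ev f ρ).Nonempty :=
    ⟨f₁, by simpa [hf₁] using lt_of_le_of_ne (hr' f₁ hf₁).1 (Ne.symm hrf₁)⟩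
  -- The minimal ratio is the largest multiple of the ray that can be subtracted while all
  -- functionals stay nonnegative. The minimizer `g` then vanishes, so the support shrinks strictly.
  obtain ⟨g, hg, hmin⟩ := Finset.exists_min_image _ (fun f => ev f h / ev f ρ) hS
  rw [Finset.mem_filter, List.mem_toFinset] at hg
  set t := ev g h / ev g ρ with ht
  have ht0 : 0 ≤ t := div_nonneg (hnn g hg.1) hg.2.le
  have hev (f) : ev f (fun m => h m - t * ρ m) = ev f h - t * ev f ρ := ev_sub_smul f h ρ t
  have hg0 : ev g (fun m => h m - t * ρ m) = 0 := by
    rw [hev, ht, div_mul_cancel₀ _ hg.2.ne', sub_self]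
  have hz : ∀ f ∈ fs, ev f h = 0 → ev f (fun m => h m - t * ρ m) = 0 := fun f hf hfh => by
    rw [hev, hfh, (hr' f hf).2 hfh]; simp
  have hlt : (fs.toFinset.filter fun f => ev f (fun m => h m - t * ρ m) ≠ 0).card < n := by
    rw [← hn]
    refine Finset.card_lt_card (Finset.ssubset_iff_of_subset ?_ |>.2 ⟨g, ?_, ?_⟩)
    · intro f hf
      rw [Finset.mem_filter, List.mem_toFinset] at hf ⊢
      exact ⟨hf.1, fun h' => hf.2 (hz f hf.1 h')⟩
    · rw [Finset.mem_filter, List.mem_toFinset]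
      exact ⟨hg.1, fun h' => hg.2.ne' ((hr' g hg.1).2 h')⟩
    · rw [Finset.mem_filter]
      exact fun h' => h'.2 hg0
  obtain ⟨c, hc, hch⟩ := ih _ hlt (h := fun m => h m - t * ρ m) (by simp [h0, hρ, r0])
    (fun f hf => by
      rw [hev]
      rcases (hr' f hf).1.eq_or_lt with h' | h'
      · rw [← h']; simpa using hnn f hf
      · have := hmin f (by simpa [hf] using h')
        rw [le_div_iff₀ h'] at this
        linarith)
    (fun f hf hfZ => hz f hf (hZ f hf hfZ)) rfl
  obtain ⟨i, hi⟩ := List.get_of_mem hr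
  refine ⟨fun j => c j + if j = i then t else 0, fun j => add_nonneg (hc j) ?_, fun m hm => ?_⟩
  · split_ifs
    exacts [ht0, le_rfl]
  · have := hch m hm
    simp only [add_mul, Finset.sum_add_distrib, ← this, ite_mul, zero_mul, Finset.sum_ite_eq',
      Finset.mem_univ, if_true, hi, hρ]
    ring

/-- For a nonzero `y`, interpret variable `i` as "functional `i` does not vanish at `y`". Two equal
sums of nonnegative terms vanish together, so the relation clauses hold. If no ray were supported in
the support of `y`, the ray clauses would hold too, contradicting the refutation. -/
theorem inCone_of_coneCert {fs : List (List (ℤ × ℕ))} {rels : List (List ℕ × List ℕ)}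
    {rays : List (ℕ → ℕ)} {Z : List ℕ} (hcert : coneCert fs rels rays Z = true)
    (hpt : ∀ y : ℕ → ℝ, y 0 = 0 → (∀ f ∈ fs, ev f y = 0) → ∀ m < 16, y m = 0)
    {h : ℕ → ℝ} (h0 : h 0 = 0) (hnn : ∀ f ∈ fs, 0 ≤ ev f h)
    (hZ : ∀ i ∈ Z, ev (fs.getD i []) h = 0) : InCone rays h := by
  simp only [coneCert, Bool.and_eq_true, List.all_eq_true, decide_eq_true_eq] at hcert
  obtain ⟨⟨⟨hfs, hrels⟩, hrays⟩, href⟩ := hcert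
  refine inCone_of_supp hpt (Z := fun f => ∃ i ∈ Z, f = fs.getD i []) ?_ h0 hnn ?_
  swap
  · rintro f - ⟨i, hi, rfl⟩
    exact hZ i hi
  intro y y0 ynn yZ yne
  by_contra hcon
  push Not at hcon
  have hnn' (i : ℕ) : 0 ≤ ev (fs.getD i []) y := by
    rcases lt_or_ge i fs.length with h | h
    · rw [List.getD_eq_getElem _ _ h]
      exact ynn _ (List.getElem_mem h)
    · rw [List.getD_eq_default _ _ h]
      exact le_rfl
  refine refute_sound (s := fun i => ev (fs.getD i []) y ≠ 0) href fun c hc => ?_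
  simp only [List.mem_append, List.mem_singleton, List.mem_map] at hc
  rcases hc with hc | hc | ⟨i, hi, rfl⟩ | rfl
  · refine relClauses_sound (fun rel hrel => ?_) c hc
    have hsum := relValid_sound hfs (hrels rel hrel) y0
    have key (A : List ℕ) : (∃ i ∈ A, ev (fs.getD i []) y ≠ 0) ↔
        (A.map fun i => ev (fs.getD i []) y).sum ≠ 0 := by
      induction A with
      | nil => simp
      | cons i A ih =>
        have hA : 0 ≤ (A.map fun i => ev (fs.getD i []) y).sum :=
          List.sum_nonneg fun a ha => by
            obtain ⟨i, -, rfl⟩ := List.mem_map.1 ha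
            exact hnn' i
        rw [List.map_cons, List.sum_cons, Ne, add_eq_zero_iff_of_nonneg (hnn' i) hA, not_and_or,
          List.exists_mem_cons_iff]
        exact or_congr Iff.rfl ih
    rw [key, key, hsum]
  · obtain ⟨r, hr, rfl⟩ := mem_rayClauses hc
    have hv := hrays r hr
    simp only [rayValid, Bool.and_eq_true, bne_iff_ne, ne_eq, List.all_eq_true,
      decide_eq_true_eq, beq_iff_eq] at hv
    obtain ⟨⟨r0, hne⟩, hrn⟩ := hv
    obtain ⟨i, hi⟩ := Nat.exists_testBit_of_ne_zero hne
    have hil : i < fs.length := by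
      by_contra hlt
      rw [testBit_suppMask, List.getD_eq_default _ _ (not_lt.1 hlt)] at hi
      exact hi rfl
    have hi' := testBit_suppMask.1 hi
    rw [List.getD_eq_getElem _ _ hil] at hi'
    obtain ⟨f, hf, hlast⟩ := hcon r hr r0 ⟨_, List.getElem_mem hil, by
      rw [ev_cast]; exact_mod_cast hi'⟩
    have := hlast (by rw [ev_cast]; exact_mod_cast hrn f hf)
    obtain ⟨j, hj, rfl⟩ := List.getElem_of_mem hf
    refine Or.inr ⟨j, testBit_suppMask.2 ?_, ?_⟩
    · rw [List.getD_eq_getElem _ _ hj]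
      have h2 := this.2
      rw [ev_cast] at h2
      exact_mod_cast h2
    · change ¬ ev (fs.getD j []) y ≠ 0
      rw [List.getD_eq_getElem _ _ hj]
      exact not_not.2 this.1
  · refine Or.inr ⟨i, by simp, not_not.2 ?_⟩
    rcases lt_or_ge i fs.length with h | h
    · refine yZ _ ?_ ⟨i, hi, rfl⟩
      rw [List.getD_eq_getElem _ _ h]
      exact List.getElem_mem h
    · rw [List.getD_eq_default _ _ h]
      rfl
  · obtain ⟨f, hf, hfy⟩ := yne
    obtain ⟨j, hj, rfl⟩ := List.getElem_of_mem hf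
    refine Or.inl ⟨j, by simp [Nat.testBit_two_pow_sub_one, hj], ?_⟩
    change ev (fs.getD j []) y ≠ 0
    rwa [List.getD_eq_getElem _ _ hj]

/-- The Shannon cone is pointed: every joint entropy is a linear combination of elemental
informations. -/
theorem eq_zero_of_shannonFns {fs : List (List (ℤ × ℕ))} (hfs : shannonFns ⊆ fs) (y : ℕ → ℝ)
    (y0 : y 0 = 0) (hy : ∀ f ∈ fs, ev f y = 0) : ∀ m < 16, y m = 0 := by
  have hy' : ∀ f ∈ shannonFns, ev f y = 0 := fun f hf => hy f (hfs hf)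
  simp [shannonFns, quads, infoFn, ev, y0] at hy'
  intro m hm
  interval_cases m <;> first | exact y0 | linarith

/-- The Ingleton cone is spanned by `ingletonRays`. -/
theorem ingletonRays_cert :
    coneCert (shannonFns ++ quads.map ingFn) fnRels ingletonRays [] = true := by
  decide +kernel

/-! ### Vectors indexed by masks -/

/-- The collection of variables with the given bit mask. -/
def bits (m : ℕ) : Finset (Fin 4) := Finset.univ.filter fun i => m.testBit i = true

/-- The bit mask of a collection of variables. -/
def maskOf (S : Finset (Fin 4)) : ℕ := ∑ i ∈ S, 2 ^ i.1

theorem bits_maskOf : ∀ S, bits (maskOf S) = S := by decide +kernel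

theorem maskOf_lt : ∀ S, maskOf S < 16 := by decide +kernel

theorem maskOf_bits : ∀ m < 16, maskOf (bits m) = m := by decide +kernel

theorem bits_or (a b : ℕ) : bits (a ||| b) = bits a ∪ bits b := by
  ext i
  simp [bits]

/-- The joint entropies of a vector, indexed by masks. -/
def maskH (x : EntropySpace15) (m : ℕ) : ℝ := formalH x (bits m)

theorem maskH_zero (x : EntropySpace15) : maskH x 0 = 0 := by
  simp [maskH, formalH, show bits 0 = ∅ by decide]

theorem maskH_maskOf (x : EntropySpace15) (S : Finset (Fin 4)) :
    maskH x (maskOf S) = formalH x S := by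
  rw [maskH, bits_maskOf]

theorem ev_infoFn (x : EntropySpace15) (a b k : ℕ) :
    ev (infoFn a b k) (maskH x) = formalI x (bits a) (bits b) (bits k) := by
  simp [infoFn, ev, maskH, formalI, bits_or]
  ring

theorem ev_neg (f : List (ℤ × ℕ)) (h : ℕ → ℝ) : ev (f.map fun t => (-t.1, t.2)) h = -ev f h := by
  induction f with
  | nil => simp [ev]
  | cons t f ih =>
    simp only [List.map_cons, ev, ih, Int.cast_neg]
    ring

theorem ev_ingFn (q : ℕ × ℕ × ℕ × ℕ) (h : ℕ → ℝ) :
    ev (ingFn q) h = ev (infoFn q.1 q.2.1 q.2.2.1) h + ev (infoFn q.1 q.2.1 q.2.2.2) h +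
      ev (infoFn q.2.2.1 q.2.2.2 0) h - ev (infoFn q.1 q.2.1 0) h := by
  rw [ingFn, ev_append, ev_append, ev_append, ev_neg, sub_eq_add_neg]

theorem ev_shannonFns_nonneg {x : EntropySpace15} (hx : x ∈ shannonCone) :
    ∀ f ∈ shannonFns, 0 ≤ ev f (maskH x) := by
  have h : ∀ f ∈ shannonFns, ∃ a b k, f = infoFn a b k := by
    intro f hf
    simp only [shannonFns, List.mem_append, List.mem_flatMap, List.mem_cons, List.not_mem_nil,
      or_false] at hf
    rcases hf with (rfl | rfl | rfl | rfl) | ⟨q, -, rfl | rfl | rfl | rfl⟩ <;> exact ⟨_, _, _, rfl⟩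
  intro f hf
  obtain ⟨a, b, k, rfl⟩ := h f hf
  rw [ev_infoFn]
  exact hx _ _ _

theorem exists_perm_of_mem_quads : ∀ q ∈ quads, ∃ σ : Equiv.Perm (Fin 4),
    bits q.1 = {σ 0} ∧ bits q.2.1 = {σ 1} ∧ bits q.2.2.1 = {σ 2} ∧ bits q.2.2.2 = {σ 3} := by
  decide +kernel

/-- The Ingleton expression is symmetric within each of its two pairs, so the 24 permutations give
only six inequalities. -/
theorem exists_quad_of_perm : ∀ σ : Equiv.Perm (Fin 4), ∃ q ∈ quads,
    ({σ 0} = bits q.1 ∧ {σ 1} = bits q.2.1 ∨ {σ 0} = bits q.2.1 ∧ {σ 1} = bits q.1) ∧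
    ({σ 2} = bits q.2.2.1 ∧ {σ 3} = bits q.2.2.2 ∨
      {σ 2} = bits q.2.2.2 ∧ {σ 3} = bits q.2.2.1) := by
  decide +kernel

theorem bits_zero : bits 0 = ∅ := by decide

theorem formalI_comm (x : EntropySpace15) (S T U : Finset (Fin 4)) :
    formalI x S T U = formalI x T S U := by
  rw [formalI, formalI, Finset.union_comm S T]
  ring

theorem mem_ingletonCone_iff {x : EntropySpace15} : x ∈ ingletonCone ↔
    x ∈ shannonCone ∧ ∀ q ∈ quads, 0 ≤ ev (ingFn q) (maskH x) := by
  refine and_congr_right fun _ => ⟨fun h q hq => ?_, fun h σ => ?_⟩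
  · obtain ⟨σ, h0, h1, h2, h3⟩ := exists_perm_of_mem_quads q hq
    have := h σ
    rw [ev_ingFn, ev_infoFn, ev_infoFn, ev_infoFn, ev_infoFn, h0, h1, h2, h3, bits_zero]
    linarith
  · obtain ⟨q, hq, h01, h23⟩ := exists_quad_of_perm σ
    have := h q hq
    rw [ev_ingFn, ev_infoFn, ev_infoFn, ev_infoFn, ev_infoFn, bits_zero] at this
    rcases h01 with ⟨h0, h1⟩ | ⟨h0, h1⟩ <;> rcases h23 with ⟨h2, h3⟩ | ⟨h2, h3⟩ <;>
      rw [h0, h1, h2, h3]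
    · linarith
    · rw [formalI_comm x (bits q.2.2.2)]; linarith
    · simp only [formalI_comm x (bits q.2.1)]; linarith
    · simp only [formalI_comm x (bits q.2.1), formalI_comm x (bits q.2.2.2)]; linarith

/-! ### Normalized rays -/

/-- The point of `ℝ¹⁴` on the ray spanned by the rank function `r`. -/
noncomputable def rayPoint (r : ℕ → ℕ) : EntropySpace14 := fun S => r (maskOf S.1) / r 15

theorem maskH_rayPoint {r : ℕ → ℕ} (r0 : r 0 = 0) (r15 : r 15 ≠ 0) {m : ℕ} (hm : m < 16) :
    maskH (withTotalOne (rayPoint r)) m = r m / r 15 := by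
  rcases Nat.eq_zero_or_pos m with rfl | hm0
  · simp [maskH_zero, r0]
  · have hne : (bits m).Nonempty := by revert m; decide +kernel
    have hu : maskOf Finset.univ = 15 := by decide
    rw [maskH, formalH, dif_pos hne, withTotalOne]
    split_ifs with h
    · have : m = 15 := by rw [← maskOf_bits m hm, ← hu]; exact congrArg _ h
      rw [this, div_self (by exact_mod_cast r15)]
    · rw [rayPoint]
      simp only [maskOf_bits m hm]

theorem withTotalOne_apply_eq (y : EntropySpace14) (S : {S : Finset (Fin 4) // S.Nonempty}) :
    withTotalOne y S = maskH (withTotalOne y) (maskOf S.1) := by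
  rw [maskH_maskOf, formalH, dif_pos S.2]

/-- Monotonicity and submodularity of a rank function. -/
def isPolymatroid (r : ℕ → ℕ) : Bool :=
  r 0 == 0 && r 15 != 0 && (List.range 16).all fun P => (List.range 16).all fun Q =>
    Nat.ble (r (Nat.land P Q)) (r P) && Nat.ble (r (Nat.land P Q) + r (Nat.lor P Q)) (r P + r Q)

theorem maskOf_union : ∀ S T, maskOf (S ∪ T) = maskOf S ||| maskOf T := by decide +kernel

theorem rayPoint_mem_shannonCone {r : ℕ → ℕ} (hr : isPolymatroid r = true) :
    rayPoint r ∈ normalized shannonCone := by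
  simp only [isPolymatroid, Bool.and_eq_true, beq_iff_eq, bne_iff_ne, ne_eq, List.all_eq_true,
    List.mem_range, Nat.ble_eq] at hr
  obtain ⟨⟨r0, r15⟩, hr⟩ := hr
  intro S T U
  rw [formalI, ← maskH_maskOf, ← maskH_maskOf, ← maskH_maskOf, ← maskH_maskOf,
    maskH_rayPoint r0 r15 (maskOf_lt _), maskH_rayPoint r0 r15 (maskOf_lt _),
    maskH_rayPoint r0 r15 (maskOf_lt _), maskH_rayPoint r0 r15 (maskOf_lt _)]
  set P := maskOf (S ∪ U) with hP
  set Q := maskOf (T ∪ U) with hQ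
  have hPQ : maskOf (S ∪ T ∪ U) = Nat.lor P Q := by
    rw [show S ∪ T ∪ U = (S ∪ U) ∪ (T ∪ U) by ext; simp; tauto, maskOf_union]; rfl
  -- `U` may be smaller than the intersection of `S ∪ U` and `T ∪ U`; monotonicity bridges the gap
  -- before submodularity applies.
  have hU : maskOf U = Nat.land (Nat.land P Q) (maskOf U) := by
    change _ = (P &&& Q) &&& _
    rw [hP, hQ, maskOf_union, maskOf_union]
    refine Nat.eq_of_testBit_eq fun i => ?_
    simp only [Nat.testBit_and, Nat.testBit_or]
    cases (maskOf U).testBit i <;> simp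
  have hlt : Nat.land P Q < 16 := lt_of_le_of_lt Nat.and_le_left (maskOf_lt _)
  have h1 := (hr P (maskOf_lt _) Q (maskOf_lt _)).2
  have h2 := (hr _ hlt _ (maskOf_lt U)).1
  rw [← hU] at h2
  rw [hPQ, ← add_div, ← sub_div, ← sub_div]
  refine div_nonneg ?_ (Nat.cast_nonneg _)
  have : (r (maskOf U) : ℝ) + r (Nat.lor P Q) ≤ r P + r Q := by exact_mod_cast by omega
  linarith

/-- A joint entropy on the section of `ℝ¹⁵`, as an affine function. -/
noncomputable def coordAff (m : ℕ) : EntropySpace14 →ᵃ[ℝ] ℝ :=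
  if h : (bits m).Nonempty then
    if h' : bits m = Finset.univ then AffineMap.const ℝ _ 1
    else (LinearMap.proj (R := ℝ) (φ := fun _ => ℝ)
      (⟨bits m, h, h'⟩ : {S : Finset (Fin 4) // S.Nonempty ∧ S ≠ Finset.univ})).toAffineMap
  else AffineMap.const ℝ _ 0

theorem coordAff_apply (m : ℕ) (y : EntropySpace14) :
    coordAff m y = maskH (withTotalOne y) m := by
  rw [coordAff, maskH, formalH]
  by_cases h : (bits m).Nonempty
  · rw [dif_pos h, dif_pos h, withTotalOne]
    split_ifs <;> simp
  · rw [dif_neg h, dif_neg h]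
    simp

/-- `ev f` on the section of `ℝ¹⁵`, as an affine function. -/
noncomputable def evAff : List (ℤ × ℕ) → (EntropySpace14 →ᵃ[ℝ] ℝ)
  | [] => AffineMap.const ℝ _ 0
  | t :: f => (t.1 : ℝ) • coordAff t.2 + evAff f

theorem evAff_apply (f : List (ℤ × ℕ)) (y : EntropySpace14) :
    evAff f y = ev f (maskH (withTotalOne y)) := by
  induction f with
  | nil => simp [evAff, ev]
  | cons t f ih => simp [evAff, ev, ih, coordAff_apply]

theorem evAff_rayPoint {r : ℕ → ℕ} (r0 : r 0 = 0) (r15 : r 15 ≠ 0) {f : List (ℤ × ℕ)}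
    (hf : ∀ t ∈ f, t.2 < 16) :
    evAff f (rayPoint r) = ((ev f fun S => (r S : ℤ) : ℤ) : ℝ) / r 15 := by
  rw [evAff_apply, ev_congr hf (fun m hm => maskH_rayPoint r0 r15 hm), ← ev_cast]
  -- Homogeneity of `ev f`, as the case of subtracting a negative multiple from zero.
  have := ev_sub_smul f (fun _ => 0) (fun m => (r m : ℝ)) (-(r 15 : ℝ)⁻¹)
  have h0 : ev f (fun _ => (0 : ℝ)) = 0 := by
    have := ev_sum (∅ : Finset ℕ) f (fun _ => 0) fun _ _ => 0
    simpa using this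
  rw [h0] at this
  simp only [zero_sub, neg_mul, neg_neg] at this
  simp only [div_eq_inv_mul, ← this]

theorem AffineMap.map_sum_smul {ι E : Type*} [AddCommGroup E] [Module ℝ E] (s : Finset ι)
    (L : E →ᵃ[ℝ] ℝ) (w : ι → ℝ) (p : ι → E) (hw : ∑ i ∈ s, w i = 1) :
    L (∑ i ∈ s, w i • p i) = ∑ i ∈ s, w i * L (p i) := by
  have h (x : E) : L x = L.linear x + L 0 := congrFun (AffineMap.decomp L) x
  have h' (i : ι) : w i * L (p i) = w i * L.linear (p i) + w i * L 0 := by rw [h (p i), mul_add]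
  rw [h, Finset.sum_congr rfl fun i _ => h' i, Finset.sum_add_distrib, ← Finset.sum_mul, hw]
  simp

theorem exists_convex_comb {rays : List (ℕ → ℕ)} (hrays : ∀ r ∈ rays, isPolymatroid r = true)
    {y : EntropySpace14} (hy : InCone rays (maskH (withTotalOne y))) :
    ∃ w : Fin rays.length → ℝ, (∀ i, 0 ≤ w i) ∧ ∑ i, w i = 1 ∧
      y = ∑ i, w i • rayPoint (rays.get i) := by
  obtain ⟨c, hc, hch⟩ := hy
  have h15 (i) : (rays.get i 15 : ℝ) ≠ 0 := by
    have := hrays _ (List.get_mem rays i)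
    simp only [isPolymatroid, Bool.and_eq_true, bne_iff_ne] at this
    exact_mod_cast this.1.2
  -- Rescaling each ray to total entropy 1 moves its total rank into the weight; the weights then
  -- add up to $H(ABCD)=1$.
  refine ⟨fun i => c i * rays.get i 15, fun i => mul_nonneg (hc i) (Nat.cast_nonneg _), ?_, ?_⟩
  · rw [← hch 15 (by norm_num)]
    simp [maskH, formalH, withTotalOne, show bits 15 = Finset.univ by decide]
  · funext S
    have h1 : y S = maskH (withTotalOne y) (maskOf S.1) := by
      rw [maskH_maskOf, formalH, dif_pos S.2.1, withTotalOne, dif_neg S.2.2]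
    rw [h1, hch _ (maskOf_lt _), Finset.sum_apply]
    refine Finset.sum_congr rfl fun i _ => ?_
    have := h15 i
    simp only [Pi.smul_apply, rayPoint, smul_eq_mul]
    field_simp

theorem lt_of_mem_shannonFns_append_ingFn :
    ∀ f ∈ shannonFns ++ quads.map ingFn, ∀ t ∈ f, t.2 < 16 := by
  decide +kernel

theorem isPolymatroid_ingletonRays : ∀ r ∈ ingletonRays, isPolymatroid r = true := by
  rw [← List.all_eq_true]
  decide +kernel

theorem exists_convex_comb_of_mem_ingletonCone {y : EntropySpace14}
    (hy : y ∈ normalized ingletonCone) :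
    ∃ w : Fin ingletonRays.length → ℝ, (∀ i, 0 ≤ w i) ∧ ∑ i, w i = 1 ∧
      y = ∑ i, w i • rayPoint (ingletonRays.get i) := by
  obtain ⟨h1, h2⟩ := mem_ingletonCone_iff.1 hy
  refine exists_convex_comb isPolymatroid_ingletonRays (inCone_of_coneCert ingletonRays_cert
    (eq_zero_of_shannonFns (List.subset_append_left _ _)) (maskH_zero _) ?_ (by simp))
  intro f hf
  rcases List.mem_append.1 hf with hf | hf
  · exact ev_shannonFns_nonneg h1 f hf
  · obtain ⟨q, hq, rfl⟩ := List.mem_map.1 hf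
    exact h2 q hq

/-! ### Edges of the Shannon polytope -/

/-- The positions of the elemental functionals that vanish on both rank functions. -/
def commonZeros (r q : ℕ → ℕ) : List ℕ :=
  (List.range 28).filter fun i => ev (shannonFns.getD i []) (fun S => (r S : ℤ)) == 0 &&
    ev (shannonFns.getD i []) (fun S => (q S : ℤ)) == 0

/-- A certificate that two rank functions span an edge of the Shannon polytope. -/
def edgeCert (r q : ℕ → ℕ) : Bool :=
  isPolymatroid r && isPolymatroid q && (List.range 16).any (fun m => r m * q 15 != q m * r 15) &&
  -- The first 24 relations are those without Ingleton functionals.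
  coneCert shannonFns (fnRels.take 24) [r, q] (commonZeros r q)

/-- The sum of the elemental functionals vanishing at both points exposes a face. On this face each
summand vanishes, so by the certificate the face lies in the conic hull of the two rays, and its
affine span is the line through the two points. -/
theorem rayPoint_mem_skeleton {r q : ℕ → ℕ} (h : edgeCert r q = true) :
    rayPoint r ∈ skeleton 1 (normalized shannonCone) := by
  simp only [edgeCert, Bool.and_eq_true] at h
  obtain ⟨⟨⟨hr, hq⟩, hne⟩, hcert⟩ := h
  have hr' := hr
  have hq' := hq
  simp only [isPolymatroid, Bool.and_eq_true, beq_iff_eq, bne_iff_ne, ne_eq] at hr' hq'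
  obtain ⟨⟨r0, r15⟩, -⟩ := hr'
  obtain ⟨⟨q0, q15⟩, -⟩ := hq'
  have hlt : ∀ f ∈ shannonFns, ∀ t ∈ f, t.2 < 16 := fun f hf =>
    lt_of_mem_shannonFns_append_ingFn f (List.mem_append_left _ hf)
  set f := sumFn shannonFns (commonZeros r q) with hf
  have hsum (y : EntropySpace14) : evAff f y = ((commonZeros r q).map fun i =>
      ev (shannonFns.getD i []) (maskH (withTotalOne y))).sum := by
    rw [evAff_apply, hf, ev_sumFn]
  have hmem : ∀ i ∈ commonZeros r q, shannonFns.getD i [] ∈ shannonFns := by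
    intro i hi
    have hi' : i < shannonFns.length := List.mem_range.1 (List.mem_of_mem_filter hi)
    rw [List.getD_eq_getElem _ _ hi']
    exact List.getElem_mem hi'
  have hnn : ∀ y ∈ normalized shannonCone, ∀ a ∈ (commonZeros r q).map fun i =>
      ev (shannonFns.getD i []) (maskH (withTotalOne y)), 0 ≤ a := by
    intro y hy a ha
    obtain ⟨i, hi, rfl⟩ := List.mem_map.1 ha
    exact ev_shannonFns_nonneg hy _ (hmem i hi)
  set F : Set EntropySpace14 := {y | y ∈ normalized shannonCone ∧ evAff f y = 0} with hF
  have hrF : rayPoint r ∈ F := by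
    refine ⟨rayPoint_mem_shannonCone hr, ?_⟩
    rw [hsum]
    refine List.sum_eq_zero fun a ha => ?_
    obtain ⟨i, hi, rfl⟩ := List.mem_map.1 ha
    rw [← evAff_apply, evAff_rayPoint r0 r15 (hlt _ (hmem i hi))]
    have := List.of_mem_filter hi
    simp only [Bool.and_eq_true, beq_iff_eq] at this
    rw [this.1, Int.cast_zero, zero_div]
  have hqF : rayPoint q ∈ F := by
    refine ⟨rayPoint_mem_shannonCone hq, ?_⟩
    rw [hsum]
    refine List.sum_eq_zero fun a ha => ?_
    obtain ⟨i, hi, rfl⟩ := List.mem_map.1 ha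
    rw [← evAff_apply, evAff_rayPoint q0 q15 (hlt _ (hmem i hi))]
    have := List.of_mem_filter hi
    simp only [Bool.and_eq_true, beq_iff_eq] at this
    rw [this.2, Int.cast_zero, zero_div]
  have hspan : affineSpan ℝ F = line[ℝ, rayPoint r, rayPoint q] := by
    refine le_antisymm (affineSpan_le.2 fun y hy => ?_) (affineSpan_mono ℝ ?_)
    · have hz : ∀ i ∈ commonZeros r q,
          ev (shannonFns.getD i []) (maskH (withTotalOne y)) = 0 := by
        have h0 := hy.2
        rw [hsum] at h0
        intro i hi
        have hle := List.single_le_sum (hnn y hy.1) _ (List.mem_map.2 ⟨i, hi, rfl⟩)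
        rw [h0] at hle
        exact le_antisymm hle (hnn y hy.1 _ (List.mem_map.2 ⟨i, hi, rfl⟩))
      obtain ⟨w, -, hw1, hwy⟩ := exists_convex_comb (rays := [r, q])
        (by simp [hr, hq]) (inCone_of_coneCert hcert
        (eq_zero_of_shannonFns (List.Subset.refl _)) (maskH_zero _)
        (ev_shannonFns_nonneg hy.1) hz)
      change w 0 + (w 1 + 0) = 1 at hw1
      change y = w 0 • rayPoint r + (w 1 • rayPoint q + 0) at hwy
      have : y = AffineMap.lineMap (rayPoint r) (rayPoint q) (w 1) := by
        rw [AffineMap.lineMap_apply_module, hwy, show w 0 = 1 - w 1 by linarith, add_zero]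
      rw [this]
      exact AffineMap.lineMap_mem_affineSpan_pair _ _ _
    · rintro y (rfl | rfl)
      exacts [hrF, hqF]
  refine ⟨F, ⟨evAff f, fun y hy => ?_, rfl⟩, ?_, hrF⟩
  · rw [hsum]
    exact List.sum_nonneg (hnn y hy)
  · rw [hspan, direction_affineSpan, vectorSpan_pair]
    refine finrank_span_singleton fun h0 => ?_
    obtain ⟨m, hm, hne⟩ := List.any_eq_true.1 hne
    rw [List.mem_range] at hm
    have h1 : rayPoint r = rayPoint q := by simpa [sub_eq_zero, eq_comm] using h0
    have h2 := congrArg (fun y => maskH (withTotalOne y) m) h1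
    simp only [maskH_rayPoint r0 r15 hm, maskH_rayPoint q0 q15 hm] at h2
    rw [div_eq_div_iff (by exact_mod_cast r15) (by exact_mod_cast q15)] at h2
    rw [bne_iff_ne] at hne
    exact hne (by exact_mod_cast h2)

/-- One edge through each point is enough. The first two rays, where only $A$ or only $B$ has rank
1, serve as the other end; two are needed because a ray does not form an edge with itself. -/
theorem edgeCert_ingletonRays : ∀ r ∈ ingletonRays, ∃ q ∈ ingletonRays.take 2,
    edgeCert r q = true := by
  have h : (ingletonRays.all fun r => (ingletonRays.take 2).any fun q => edgeCert r q) = true := by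
    decide +kernel
  intro r hr
  exact List.any_eq_true.1 (List.all_eq_true.1 h r hr)

theorem rayPoint_mem_skeleton_of_mem {r : ℕ → ℕ} (hr : r ∈ ingletonRays) :
    rayPoint r ∈ skeleton 1 (normalized shannonCone) :=
  let ⟨_, _, h⟩ := edgeCert_ingletonRays r hr
  rayPoint_mem_skeleton h

/-! ### Edges that violate the Ingleton inequality -/

/-- The rank function of the Shannon cone that violates the Ingleton inequality for `q`. -/
def vamosRay (q : ℕ × ℕ × ℕ × ℕ) (S : ℕ) : ℕ :=
  bif S == 0 then 0 else bif S == Nat.lor q.2.2.1 q.2.2.2 then 4 else min 4 (pc S + 1)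

/-- The rays of the Ingleton cone that are adjacent to `vamosRay q`. -/
def vamosNeighbors (q : ℕ × ℕ × ℕ × ℕ) : List (ℕ → ℕ) :=
  ingletonRays.filter fun r => ev (ingFn q) (fun S => (r S : ℤ)) == 0 &&
    (shannonFns.countP fun f => ev f (fun S => (vamosRay q S : ℤ)) == 0 &&
      ev f (fun S => (r S : ℤ)) != 0) == 1

/-- The relations that involve no Ingleton functional except the `k`-th, rewritten in terms of its
negative, which gets index 28. -/
def vamosRels (k : ℕ) : List (List ℕ × List ℕ) :=
  fnRels.filterMap fun rel =>
    bif (rel.1 ++ rel.2).all fun i => Nat.blt i 28 || Nat.beq i k then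
      some (rel.1.filter (Nat.blt · 28) ++ (rel.2.filter (Nat.beq k)).map fun _ => 28,
        rel.2.filter (Nat.blt · 28) ++ (rel.1.filter (Nat.beq k)).map fun _ => 28)
    else none

/-- The three conditional informations within a triple of variables. -/
def tripleFns (a b c : ℕ) : List (List (ℤ × ℕ)) := [infoFn a b c, infoFn a c b, infoFn b c a]

/-- The part of the Shannon cone that violates the Ingleton inequality for `q` is a simplicial
cone, in which no neighbor of `vamosRay q` involves both triples containing the first pair. -/
def vamosCert (k : ℕ) (q : ℕ × ℕ × ℕ × ℕ) : Bool :=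
  coneCert (shannonFns ++ [(ingFn q).map fun t => (-t.1, t.2)]) (vamosRels (28 + k))
    (vamosRay q :: vamosNeighbors q) [] &&
  isPolymatroid (vamosRay q) &&
  (tripleFns q.1 q.2.1 q.2.2.1).all fun f => (tripleFns q.1 q.2.1 q.2.2.2).all fun g =>
    ev f (fun S => (vamosRay q S : ℤ)) == 0 && ev g (fun S => (vamosRay q S : ℤ)) == 0 &&
    (vamosNeighbors q).all fun r =>
      ev f (fun S => (r S : ℤ)) == 0 || ev g (fun S => (r S : ℤ)) == 0

theorem vamosCert_quads : ∀ q ∈ quads, ∃ k, vamosCert k q = true := by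
  have h : ((List.range 6).all fun k => vamosCert k (quads.getD k (0, 0, 0, 0))) = true := by
    decide +kernel
  have h' := fun k hk => List.all_eq_true.1 h k (List.mem_range.2 hk)
  intro q hq
  obtain ⟨k, hk, rfl⟩ := List.getElem_of_mem hq
  refine ⟨k, ?_⟩
  rw [← List.getD_eq_getElem _ (0, 0, 0, 0) hk]
  exact h' k hk

theorem lt_of_mem_tripleFns : ∀ q ∈ quads,
    ∀ f ∈ tripleFns q.1 q.2.1 q.2.2.1 ++ tripleFns q.1 q.2.1 q.2.2.2, ∀ t ∈ f, t.2 < 16 := by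
  decide +kernel

/-- If a point on an edge of a convex set is a convex combination of points of the set, those with
positive weight lie on a line. -/
theorem collinear_of_convex_comb {E : Type*} [AddCommGroup E] [Module ℝ E] {P F : Set E}
    (hF : IsExtremeSegment P F) (hdim : Module.finrank ℝ (affineSpan ℝ F).direction = 1)
    {n : ℕ} {w : Fin n → ℝ} {p : Fin n → E} (hw : ∀ i, 0 ≤ w i) (hw1 : ∑ i, w i = 1)
    (hp : ∀ i, p i ∈ P) (hmem : ∑ i, w i • p i ∈ F) :
    ∃ v : E, ∀ i j, 0 < w i → 0 < w j → ∃ c : ℝ, p i = c • v + p j := by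
  obtain ⟨L, hL, rfl⟩ := hF
  have hsum := hmem.2
  -- A vanishing weighted sum of nonnegative values of `L` puts every point of positive weight on
  -- the face.
  rw [AffineMap.map_sum_smul _ L w p hw1, Finset.sum_eq_zero_iff_of_nonneg
    fun i _ => mul_nonneg (hw i) (hL _ (hp i))] at hsum
  have hpF : ∀ i, 0 < w i → p i ∈ affineSpan ℝ {x | x ∈ P ∧ L x = 0} := fun i hi =>
    subset_affineSpan ℝ _ ⟨hp i, (mul_eq_zero.1 (hsum i (Finset.mem_univ i))).resolve_left hi.ne'⟩
  obtain ⟨v, -, hv⟩ := finrank_eq_one_iff'.1 hdim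
  refine ⟨v, fun i j hi hj => ?_⟩
  obtain ⟨c, hc⟩ := hv ⟨p i -ᵥ p j, AffineSubspace.vsub_mem_direction (hpF i hi) (hpF j hj)⟩
  refine ⟨c, ?_⟩
  have := congrArg Subtype.val hc
  simp only [SetLike.val_smul, vsub_eq_sub] at this
  rw [this, sub_add_cancel]

theorem mem_ingletonCone_of_mem_skeleton {y : EntropySpace14}
    (hy : y ∈ skeleton 1 (normalized shannonCone))
    (hZY : ∀ q ∈ quads, ∀ c, c = q.2.2.1 ∨ c = q.2.2.2 →
      0 ≤ ev (ingFn q) (maskH (withTotalOne y)) +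
        ((tripleFns q.1 q.2.1 c).map fun f => ev f (maskH (withTotalOne y))).sum) :
    y ∈ normalized ingletonCone := by
  obtain ⟨F, hF, hdim, hyF⟩ := hy
  have hyP : y ∈ normalized shannonCone := by
    obtain ⟨L, -, rfl⟩ := hF
    exact hyF.1
  refine mem_ingletonCone_iff.2 ⟨hyP, fun q hq => ?_⟩
  by_contra! hneg
  obtain ⟨k, hk⟩ := vamosCert_quads q hq
  simp only [vamosCert, Bool.and_eq_true, Bool.or_eq_true, beq_iff_eq, List.all_eq_true] at hk
  obtain ⟨⟨hcert, hpoly⟩, htri⟩ := hk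
  -- With the Ingleton expression negative, Zhang–Yeung forces a positive information within each of
  -- the two triples.
  have hpos (c : ℕ) (hc : c = q.2.2.1 ∨ c = q.2.2.2) :
      ∃ f ∈ tripleFns q.1 q.2.1 c, 0 < ev f (maskH (withTotalOne y)) := by
    by_contra! hcon
    have h1 := hZY q hq c hc
    simp only [tripleFns, List.map_cons, List.map_nil, List.sum_cons, List.sum_nil,
      List.forall_mem_cons] at h1 hcon
    linarith [hcon.1, hcon.2.1, hcon.2.2.1]
  obtain ⟨f, hf, hfy⟩ := hpos _ (Or.inl rfl)
  obtain ⟨g, hg, hgy⟩ := hpos _ (Or.inr rfl)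
  have hf16 := lt_of_mem_tripleFns q hq f (List.mem_append_left _ hf)
  have hg16 := lt_of_mem_tripleFns q hq g (List.mem_append_right _ hg)
  have hi16 : ∀ t ∈ ingFn q, t.2 < 16 := lt_of_mem_shannonFns_append_ingFn _
    (List.mem_append_right _ (List.mem_map.2 ⟨q, hq, rfl⟩))
  obtain ⟨⟨hfv, hgv⟩, hfg⟩ := htri f hf g hg
  set rays := vamosRay q :: vamosNeighbors q
  have hrays : ∀ r ∈ rays, isPolymatroid r = true := by
    intro r hr
    rcases List.mem_cons.1 hr with rfl | hr
    · exact hpoly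
    · exact isPolymatroid_ingletonRays r (List.mem_of_mem_filter hr)
  obtain ⟨w, hw, hw1, hwy⟩ := exists_convex_comb hrays (inCone_of_coneCert hcert
    (eq_zero_of_shannonFns (List.subset_append_left _ _)) (maskH_zero (withTotalOne y)) (by
      intro f hf
      rcases List.mem_append.1 hf with hf | hf
      · exact ev_shannonFns_nonneg hyP f hf
      · rw [List.mem_singleton.1 hf, ev_neg]
        linarith) (by simp))
  have hr0 (i) : rays.get i 0 = 0 ∧ rays.get i 15 ≠ 0 := by
    have := hrays _ (List.get_mem rays i)
    simp only [isPolymatroid, Bool.and_eq_true, beq_iff_eq, bne_iff_ne] at this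
    exact this.1
  have hval (f : List (ℤ × ℕ)) (hf : ∀ t ∈ f, t.2 < 16) (i) :
      evAff f (rayPoint (rays.get i)) =
        ((ev f fun S => (rays.get i S : ℤ) : ℤ) : ℝ) / rays.get i 15 :=
    evAff_rayPoint (hr0 i).1 (hr0 i).2 hf
  have hsum (f : List (ℤ × ℕ)) :
      ev f (maskH (withTotalOne y)) = ∑ i, w i * evAff f (rayPoint (rays.get i)) := by
    rw [← evAff_apply, hwy, AffineMap.map_sum_smul _ _ _ _ hw1]
  have hcase : ∀ i : Fin rays.length, i = ⟨0, by simp [rays]⟩ ∨ rays.get i ∈ vamosNeighbors q := by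
    rintro ⟨_ | i, hi⟩
    · exact Or.inl rfl
    · exact Or.inr (List.getElem_mem _)
  have hex (f : List (ℤ × ℕ)) (hf : 0 < ev f (maskH (withTotalOne y))) :
      ∃ i, 0 < w i ∧ evAff f (rayPoint (rays.get i)) ≠ 0 := by
    rw [hsum] at hf
    obtain ⟨i, -, hi⟩ := Finset.exists_ne_zero_of_sum_ne_zero hf.ne'
    exact ⟨i, lt_of_le_of_ne (hw i) (Ne.symm (left_ne_zero_of_mul hi)), right_ne_zero_of_mul hi⟩
  set i₀ : Fin rays.length := ⟨0, by simp [rays]⟩ with hi₀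
  -- All neighbors lie on the Ingleton hyperplane, so only the apex can make the expression negative
  -- at `y`.
  have hw0 : 0 < w i₀ := by
    refine lt_of_le_of_ne (hw _) fun h0 => hneg.not_ge (le_of_eq ?_)
    rw [hsum]
    refine (Finset.sum_eq_zero fun i _ => ?_).symm
    rcases hcase i with rfl | hi
    · rw [← h0, zero_mul]
    · have := List.of_mem_filter hi
      simp only [Bool.and_eq_true, beq_iff_eq] at this
      rw [hval _ hi16, this.1, Int.cast_zero, zero_div, mul_zero]
  obtain ⟨i, hwi, hfi⟩ := hex f hfy
  obtain ⟨j, hwj, hgj⟩ := hex g hgy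
  have hf0 : evAff f (rayPoint (rays.get i₀)) = 0 := by
    rw [hval _ hf16, show rays.get i₀ = vamosRay q from rfl, hfv, Int.cast_zero, zero_div]
  have hg0 : evAff g (rayPoint (rays.get i₀)) = 0 := by
    rw [hval _ hg16, show rays.get i₀ = vamosRay q from rfl, hgv, Int.cast_zero, zero_div]
  have hfj : evAff f (rayPoint (rays.get j)) = 0 := by
    rcases hcase j with rfl | hj
    · exact hf0
    · rcases hfg _ hj with h | h
      · rw [hval _ hf16, h, Int.cast_zero, zero_div]
      · refine absurd ?_ hgj
        rw [hval _ hg16, h, Int.cast_zero, zero_div]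
  obtain ⟨v, hv⟩ := collinear_of_convex_comb hF hdim hw hw1
    (fun i => rayPoint_mem_shannonCone (hrays _ (List.get_mem rays i))) (hwy ▸ hyF)
  obtain ⟨a, ha⟩ := hv i i₀ hwi hw0
  obtain ⟨b, hb⟩ := hv j i₀ hwj hw0
  have hlin (f : List (ℤ × ℕ)) (c : ℝ) (x : EntropySpace14) :
      evAff f (c • v + x) = c * (evAff f).linear v + evAff f x := by
    have := (evAff f).map_vadd x (c • v)
    simpa using this
  -- On the line through the apex, `f` vanishes at the apex but not at point `i`, so its slope is
  -- nonzero. As `f` vanishes at point `j`, this point is the apex itself, where `g` vanishes: a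
  -- contradiction.
  rw [hb, hlin, hf0, add_zero] at hfj
  rw [ha, hlin, hf0, add_zero] at hfi
  rw [hb, hlin, hg0, add_zero] at hgj
  exact hgj (by rw [(mul_eq_zero.1 hfj).resolve_right (right_ne_zero_of_mul hfi), zero_mul])

/-! ### Entropies of functions on a discrete probability space -/

open scoped ENNReal in
/-- The Shannon entropy, in bits, of the function `f`. -/
noncomputable def ent {Ω β : Type} (p : PMF Ω) (f : Ω → β) : ℝ≥0∞ :=
  ∑' ω, p ω * ENNReal.ofReal (-Real.logb 2 ((p.map f) (f ω)).toReal)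

section ent

open scoped ENNReal

variable {Ω β γ δ ε : Type}

theorem PMF.tsum_map_mul (p : PMF Ω) (f : Ω → β) (g : β → ℝ≥0∞) :
    ∑' b, (p.map f) b * g b = ∑' ω, p ω * g (f ω) := by
  classical
  simp only [PMF.map_apply, ← ENNReal.tsum_mul_right]
  rw [ENNReal.tsum_comm]
  refine tsum_congr fun ω => ?_
  rw [tsum_eq_single (f ω)]
  · simp
  · intro b hb
    simp [hb]

theorem ent_map (p : PMF Ω) (f : Ω → β) (g : β → γ) : ent (p.map f) g = ent p (g ∘ f) := by
  rw [ent, ent, PMF.map_comp]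
  exact PMF.tsum_map_mul p f fun b => ENNReal.ofReal (-Real.logb 2 ((p.map (g ∘ f)) (g b)).toReal)

theorem PMF.toReal_le_one (q : PMF β) (b : β) : (q b).toReal ≤ 1 :=
  ENNReal.toReal_le_of_le_ofReal zero_le_one (by simpa using q.coe_le_one b)

theorem neg_logb_nonneg (q : PMF β) (b : β) : 0 ≤ -Real.logb 2 (q b).toReal := by
  have := Real.logb_nonpos one_lt_two ENNReal.toReal_nonneg (q.toReal_le_one b)
  linarith

theorem neg_mul_logb_nonneg (q : PMF β) (b : β) :
    0 ≤ -((q b).toReal * Real.logb 2 (q b).toReal) := by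
  rw [← mul_neg]
  exact mul_nonneg ENNReal.toReal_nonneg (neg_logb_nonneg q b)

theorem ent_eq_tsum (p : PMF Ω) (f : Ω → β) : ent p f = ∑' b,
    ENNReal.ofReal (-(((p.map f) b).toReal * Real.logb 2 ((p.map f) b).toReal)) := by
  rw [ent, ← PMF.tsum_map_mul p f fun b => ENNReal.ofReal (-Real.logb 2 ((p.map f) b).toReal)]
  refine tsum_congr fun b => ?_
  rw [← mul_neg, ENNReal.ofReal_mul ENNReal.toReal_nonneg,
    ENNReal.ofReal_toReal ((p.map f).apply_ne_top b)]

theorem hasEntropy_map_iff {p : PMF Ω} {f : Ω → β} {h : ℝ} :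
    HasEntropy (p.map f) h ↔ 0 ≤ h ∧ ent p f = ENNReal.ofReal h := by
  rw [HasEntropy, ent_eq_tsum]
  have hnn := neg_mul_logb_nonneg (p.map f)
  constructor
  · intro hs
    refine ⟨hs.nonneg hnn, ?_⟩
    rw [← hs.tsum_eq, ENNReal.ofReal_tsum_of_nonneg hnn hs.summable]
  · rintro ⟨h0, hs⟩
    have hsum : Summable fun b =>
        -(((p.map f) b).toReal * Real.logb 2 ((p.map f) b).toReal) := by
      have := ENNReal.summable_toReal (hs ▸ ENNReal.ofReal_ne_top :
        ∑' b, ENNReal.ofReal (-(((p.map f) b).toReal * Real.logb 2 ((p.map f) b).toReal)) ≠ ∞)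
      simpa only [ENNReal.toReal_ofReal (hnn _)] using this
    rw [← ENNReal.ofReal_tsum_of_nonneg hnn hsum,
      ENNReal.ofReal_eq_ofReal_iff (tsum_nonneg hnn) h0] at hs
    exact hs ▸ hsum.hasSum

theorem PMF.map_apply_apply (p : PMF Ω) (f : Ω → β) [DecidableEq β] (ω : Ω) :
    (p.map f) (f ω) = ∑' ω', if f ω = f ω' then p ω' else 0 := by
  rw [PMF.map_apply]
  exact tsum_congr fun ω' => by congr

theorem PMF.le_map_apply (p : PMF Ω) (f : Ω → β) (ω : Ω) : p ω ≤ (p.map f) (f ω) := by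
  classical
  rw [PMF.map_apply_apply]
  exact le_trans (by simp) (ENNReal.le_tsum ω)

theorem PMF.map_apply_ne_zero (p : PMF Ω) (f : Ω → β) {ω : Ω} (h : p ω ≠ 0) :
    (p.map f) (f ω) ≠ 0 :=
  fun h0 => h (le_antisymm (h0 ▸ p.le_map_apply f ω) bot_le)

theorem PMF.toReal_map_apply_pos (p : PMF Ω) (f : Ω → β) {ω : Ω} (h : p ω ≠ 0) :
    0 < ((p.map f) (f ω)).toReal :=
  ENNReal.toReal_pos (p.map_apply_ne_zero f h) (PMF.apply_ne_top _ _)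

/-- Fibres of `f` lie in fibres of `g`, so passing to `g` raises the probability of the observed
value and lowers its surprise at every `ω`. -/
theorem ent_mono (p : PMF Ω) {f : Ω → β} {g : Ω → γ} (h : ∀ ω ω', f ω = f ω' → g ω = g ω') :
    ent p g ≤ ent p f := by
  classical
  refine ENNReal.tsum_le_tsum fun ω => ?_
  by_cases hω : p ω = 0
  · simp [hω]
  gcongr
  · norm_num
  · exact p.toReal_map_apply_pos f hω
  · exact PMF.apply_ne_top _ _
  · rw [PMF.map_apply_apply, PMF.map_apply_apply]
    refine ENNReal.tsum_le_tsum fun ω' => ?_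
    split_ifs with h1 h2
    exacts [le_rfl, absurd (h _ _ h1) h2, bot_le, le_rfl]

theorem ent_congr (p : PMF Ω) {f : Ω → β} {g : Ω → γ} (h : ∀ ω ω', f ω = f ω' ↔ g ω = g ω') :
    ent p f = ent p g :=
  le_antisymm (ent_mono p fun ω ω' => (h ω ω').2) (ent_mono p fun ω ω' => (h ω ω').1)

theorem PMF.tsum_map_prodMk_left (p : PMF Ω) (X : Ω → β) (Z : Ω → γ) (z : γ) :
    ∑' x, (p.map fun ω => (X ω, Z ω)) (x, z) = (p.map Z) z := by
  classical
  simp only [PMF.map_apply]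
  rw [ENNReal.tsum_comm]
  refine tsum_congr fun ω => ?_
  rw [tsum_eq_single (X ω)]
  · simp
  · intro x hx
    simp [hx]

theorem PMF.tsum_map_prodMk_right (p : PMF Ω) (X : Ω → β) (Z : Ω → γ) (x : β) :
    ∑' z, (p.map fun ω => (X ω, Z ω)) (x, z) = (p.map X) x := by
  classical
  simp only [PMF.map_apply]
  rw [ENNReal.tsum_comm]
  refine tsum_congr fun ω => ?_
  rw [tsum_eq_single (Z ω)]
  · simp
  · intro x hx
    simp [hx]

/-- Summed over triples, the joint probability cancels where it is nonzero; then $p(x,z)$ and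
$p(y,z)$ sum out to $p(z)$. -/
theorem tsum_ratio_le_one (p : PMF Ω) (X : Ω → β) (Y : Ω → γ) (Z : Ω → δ) :
    ∑' ω, p ω * ((p.map fun ω => (X ω, Z ω)) (X ω, Z ω) * (p.map fun ω => (Y ω, Z ω)) (Y ω, Z ω) /
      ((p.map Z) (Z ω) * (p.map fun ω => (X ω, Y ω, Z ω)) (X ω, Y ω, Z ω))) ≤ 1 := by
  set P := p.map fun ω => (X ω, Y ω, Z ω)
  set PX := p.map fun ω => (X ω, Z ω)
  set PY := p.map fun ω => (Y ω, Z ω)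
  set PZ := p.map Z
  calc _ = ∑' b : β × γ × δ, P b * (PX (b.1, b.2.2) * PY (b.2.1, b.2.2) / (PZ b.2.2 * P b)) :=
        (PMF.tsum_map_mul p (fun ω => (X ω, Y ω, Z ω)) fun b =>
          PX (b.1, b.2.2) * PY (b.2.1, b.2.2) / (PZ b.2.2 * P b)).symm
    _ ≤ ∑' b : β × γ × δ, PX (b.1, b.2.2) * PY (b.2.1, b.2.2) / PZ b.2.2 := by
        refine ENNReal.tsum_le_tsum fun b => ?_
        by_cases hb : P b = 0
        · simp [hb]
        · rw [mul_comm (PZ b.2.2), ← mul_div_assoc,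
            ENNReal.mul_div_mul_left _ _ hb (PMF.apply_ne_top _ _)]
    _ = ∑' z, ∑' y, ∑' x, PX (x, z) * PY (y, z) / PZ z := by
        rw [ENNReal.tsum_prod']
        simp only [ENNReal.tsum_prod']
        rw [ENNReal.tsum_comm]
        simp only [fun y => ENNReal.tsum_comm (f := fun x z => PX (x, z) * PY (y, z) / PZ z)]
        rw [ENNReal.tsum_comm]
    _ = ∑' z, PZ z * PZ z / PZ z := by
        refine tsum_congr fun z => ?_
        simp only [div_eq_mul_inv, ENNReal.tsum_mul_right, ENNReal.tsum_mul_left]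
        rw [PMF.tsum_map_prodMk_left, PMF.tsum_map_prodMk_left]
    _ ≤ ∑' z, PZ z := by
        refine ENNReal.tsum_le_tsum fun z => ?_
        rw [mul_div_assoc]
        exact mul_le_of_le_one_right bot_le ENNReal.div_self_le_one
    _ = 1 := PZ.tsum_coe

/-- Apply $\log t\le t-1$ pointwise to the ratio of `tsum_ratio_le_one` and average. The $-1$ is
moved to the left as `κ * p ω`, so that every term is nonnegative and infinite entropies are
allowed; the finite constant `κ` cancels at the end. -/
theorem ent_prod_submod (p : PMF Ω) (X : Ω → β) (Y : Ω → γ) (Z : Ω → δ) :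
    ent p Z + ent p (fun ω => (X ω, Y ω, Z ω)) ≤
      ent p (fun ω => (X ω, Z ω)) + ent p (fun ω => (Y ω, Z ω)) := by
  set κ : ℝ := (Real.log 2)⁻¹ with hκ
  have hκ0 : 0 < κ := inv_pos.2 (Real.log_pos one_lt_two)
  set t : Ω → ℝ≥0∞ := fun ω =>
    (p.map fun ω => (X ω, Z ω)) (X ω, Z ω) * (p.map fun ω => (Y ω, Z ω)) (Y ω, Z ω) /
      ((p.map Z) (Z ω) * (p.map fun ω => (X ω, Y ω, Z ω)) (X ω, Y ω, Z ω)) with ht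
  have hpt (ω : Ω) :
      p ω * ENNReal.ofReal (-Real.logb 2 ((p.map Z) (Z ω)).toReal) +
        p ω * ENNReal.ofReal
          (-Real.logb 2 ((p.map fun ω => (X ω, Y ω, Z ω)) (X ω, Y ω, Z ω)).toReal) +
        ENNReal.ofReal κ * p ω ≤
      p ω * ENNReal.ofReal (-Real.logb 2 ((p.map fun ω => (X ω, Z ω)) (X ω, Z ω)).toReal) +
        p ω * ENNReal.ofReal (-Real.logb 2 ((p.map fun ω => (Y ω, Z ω)) (Y ω, Z ω)).toReal) +
        ENNReal.ofReal κ * (p ω * t ω) := by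
    by_cases hω : p ω = 0
    · simp [hω]
    have ha := p.toReal_map_apply_pos Z hω
    have hb := p.toReal_map_apply_pos (fun ω => (X ω, Y ω, Z ω)) hω
    have hc := p.toReal_map_apply_pos (fun ω => (X ω, Z ω)) hω
    have hd := p.toReal_map_apply_pos (fun ω => (Y ω, Z ω)) hω
    have na := neg_logb_nonneg (p.map Z) (Z ω)
    have nb := neg_logb_nonneg (p.map fun ω => (X ω, Y ω, Z ω)) (X ω, Y ω, Z ω)
    have nc := neg_logb_nonneg (p.map fun ω => (X ω, Z ω)) (X ω, Z ω)
    have nd := neg_logb_nonneg (p.map fun ω => (Y ω, Z ω)) (Y ω, Z ω)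
    have htr : t ω = ENNReal.ofReal (t ω).toReal := by
      rw [ENNReal.ofReal_toReal]
      refine ENNReal.div_ne_top (ENNReal.mul_ne_top (PMF.apply_ne_top _ _)
        (PMF.apply_ne_top _ _)) (mul_ne_zero ?_ ?_)
      · exact p.map_apply_ne_zero Z hω
      · exact p.map_apply_ne_zero (fun ω => (X ω, Y ω, Z ω)) hω
    rw [mul_left_comm, mul_comm (ENNReal.ofReal κ) (p ω), ← mul_add, ← mul_add, ← mul_add,
      ← mul_add]
    refine mul_le_mul_right ?_ _
    rw [htr, ← ENNReal.ofReal_mul hκ0.le, ← ENNReal.ofReal_add na nb,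
      ← ENNReal.ofReal_add (add_nonneg na nb) hκ0.le, ← ENNReal.ofReal_add nc nd,
      ← ENNReal.ofReal_add (add_nonneg nc nd) (mul_nonneg hκ0.le ENNReal.toReal_nonneg)]
    refine ENNReal.ofReal_le_ofReal ?_
    simp only [ht, ENNReal.toReal_div, ENNReal.toReal_mul]
    set a := ((p.map Z) (Z ω)).toReal
    set b := ((p.map fun ω => (X ω, Y ω, Z ω)) (X ω, Y ω, Z ω)).toReal
    set c := ((p.map fun ω => (X ω, Z ω)) (X ω, Z ω)).toReal
    set d := ((p.map fun ω => (Y ω, Z ω)) (Y ω, Z ω)).toReal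
    have h1 := Real.log_le_sub_one_of_pos (x := c * d / (a * b)) (by positivity)
    rw [Real.log_div (by positivity) (by positivity), Real.log_mul hc.ne' hd.ne',
      Real.log_mul ha.ne' hb.ne'] at h1
    have h2 := mul_le_mul_of_nonneg_left h1 hκ0.le
    simp only [Real.logb, div_eq_inv_mul (Real.log _), ← hκ]
    linarith
  have h := ENNReal.tsum_le_tsum hpt
  simp only [ENNReal.tsum_add, ENNReal.tsum_mul_left, p.tsum_coe, mul_one] at h
  have h3 : ENNReal.ofReal κ * ∑' ω, p ω * t ω ≤ ENNReal.ofReal κ :=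
    mul_le_of_le_one_right bot_le (tsum_ratio_le_one p X Y Z)
  exact (ENNReal.add_le_add_iff_right ENNReal.ofReal_ne_top).1 (h.trans (add_le_add le_rfl h3))

/-- Submodularity of entropy: `w` is a common function of `u` and `v`, and `t` is their join. -/
theorem ent_submod (p : PMF Ω) {u : Ω → β} {v : Ω → γ} {w : Ω → δ} {t : Ω → ε}
    (hu : ∀ ω ω', u ω = u ω' → w ω = w ω') (hv : ∀ ω ω', v ω = v ω' → w ω = w ω')
    (ht : ∀ ω ω', t ω = t ω' ↔ u ω = u ω' ∧ v ω = v ω') :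
    ent p w + ent p t ≤ ent p u + ent p v := by
  have h := ent_prod_submod p u v w
  have h1 : ent p (fun ω => (u ω, v ω, w ω)) = ent p t := ent_congr p fun ω ω' => by
    simp only [Prod.mk.injEq, ht]
    exact ⟨fun h => ⟨h.1, h.2.1⟩, fun h => ⟨h.1, h.2, hu _ _ h.1⟩⟩
  have h2 : ent p (fun ω => (u ω, w ω)) = ent p u := ent_congr p fun ω ω' => by
    simp only [Prod.mk.injEq]
    exact ⟨fun h => h.1, fun h => ⟨h, hu _ _ h⟩⟩
  have h3 : ent p (fun ω => (v ω, w ω)) = ent p v := ent_congr p fun ω ω' => by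
    simp only [Prod.mk.injEq]
    exact ⟨fun h => h.1, fun h => ⟨h, hv _ _ h⟩⟩
  rwa [h1, h2, h3] at h

/-- There is a copy of `g` that is independent of the rest given `f`. -/
theorem exists_copy (p : PMF Ω) (f : Ω → β) (g : Ω → γ) : ∃ p' : PMF (Ω × γ),
    p'.map Prod.fst = p ∧
    p'.map (fun x => (f x.1, x.2)) = p.map (fun ω => (f ω, g ω)) ∧
    ent p' id + ent p f = ent p (fun ω => (f ω, g ω)) + ent p id := by
  classical
  set Q := p.map fun ω => (f ω, g ω) with hQ
  have hQf (b : β) : ∑' c, Q (b, c) = (p.map f) b := p.tsum_map_prodMk_right f g b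
  have hcancel (ω : Ω) : p ω * ((p.map f) (f ω) / (p.map f) (f ω)) = p ω := by
    by_cases hω : p ω = 0
    · simp [hω]
    · rw [ENNReal.div_self (p.map_apply_ne_zero f hω) (PMF.apply_ne_top _ _), mul_one]
  have hfst (ω : Ω) : ∑' c, p ω * (Q (f ω, c) / (p.map f) (f ω)) = p ω := by
    simp only [ENNReal.tsum_mul_left, div_eq_mul_inv, ENNReal.tsum_mul_right, hQf]
    exact hcancel ω
  -- Given `ω`, the new coordinate has the conditional law of `g` given the value `f ω`.
  let p' : PMF (Ω × γ) := ⟨fun x => p x.1 * (Q (f x.1, x.2) / (p.map f) (f x.1)), by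
    have : ∑' x : Ω × γ, p x.1 * (Q (f x.1, x.2) / (p.map f) (f x.1)) = 1 := by
      rw [ENNReal.tsum_prod']
      simp only [hfst, p.tsum_coe]
    exact this ▸ ENNReal.summable.hasSum⟩
  have hp' (x : Ω × γ) : p' x = p x.1 * (Q (f x.1, x.2) / (p.map f) (f x.1)) := rfl
  have h1 : p'.map Prod.fst = p := by
    ext ω
    rw [PMF.map_apply, ENNReal.tsum_prod', tsum_eq_single ω]
    · simpa [hp'] using hfst ω
    · intro ω' hω'
      simp [hω'.symm]
  have h2 : p'.map (fun x => (f x.1, x.2)) = Q := by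
    ext ⟨b, c⟩
    rw [PMF.map_apply, ENNReal.tsum_prod']
    have : ∀ ω, ∑' c', (if (b, c) = (f ω, c') then p' (ω, c') else 0) =
        (if b = f ω then p ω else 0) * (Q (b, c) / (p.map f) b) := by
      intro ω
      rw [tsum_eq_single c]
      · by_cases hb : b = f ω
        · simp [hb, hp']
        · simp [hb]
      · intro c' hc'
        simp [hc'.symm]
    refine (tsum_congr fun ω => Eq.trans (tsum_congr fun c' => by congr) (this ω)).trans ?_
    rw [ENNReal.tsum_mul_right]
    have hb : ∑' ω, (if b = f ω then p ω else 0) = (p.map f) b := by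
      rw [PMF.map_apply]
    rw [hb]
    by_cases h0 : (p.map f) b = 0
    · have := hQf b
      rw [h0, ENNReal.tsum_eq_zero] at this
      rw [h0, zero_mul, this c]
    · exact ENNReal.mul_div_cancel h0 (PMF.apply_ne_top _ _)
  refine ⟨p', h1, h2, ?_⟩
  have e1 : ent p f = ∑' x, p' x * ENNReal.ofReal (-Real.logb 2 ((p.map f) (f x.1)).toReal) := by
    rw [← PMF.tsum_map_mul p' Prod.fst fun ω =>
      ENNReal.ofReal (-Real.logb 2 ((p.map f) (f ω)).toReal), h1, ent]
  have e2 : ent p id = ∑' x, p' x * ENNReal.ofReal (-Real.logb 2 (p x.1).toReal) := by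
    rw [← PMF.tsum_map_mul p' Prod.fst fun ω =>
      ENNReal.ofReal (-Real.logb 2 (p ω).toReal), h1, ent, PMF.map_id]
    rfl
  have e3 : ent p (fun ω => (f ω, g ω)) =
      ∑' x, p' x * ENNReal.ofReal (-Real.logb 2 (Q (f x.1, x.2)).toReal) := by
    rw [← PMF.tsum_map_mul p' (fun x => (f x.1, x.2)) fun b =>
      ENNReal.ofReal (-Real.logb 2 (Q b).toReal), h2, hQ,
      PMF.tsum_map_mul p (fun ω => (f ω, g ω)) fun b => ENNReal.ofReal (-Real.logb 2 (Q b).toReal)]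
    rfl
  have e4 : ent p' id = ∑' x, p' x * ENNReal.ofReal (-Real.logb 2 (p' x).toReal) := by
    rw [ent, PMF.map_id]
    rfl
  rw [e1, e2, e3, e4, ← ENNReal.tsum_add, ← ENNReal.tsum_add]
  refine tsum_congr fun x => ?_
  by_cases hx : p' x = 0
  · simp [hx]
  rw [← mul_add, ← mul_add, ← ENNReal.ofReal_add (neg_logb_nonneg _ _) (neg_logb_nonneg _ _),
    ← ENNReal.ofReal_add (neg_logb_nonneg _ _) (neg_logb_nonneg _ _)]
  have hx' := hx
  rw [hp', ← ne_eq, mul_ne_zero_iff] at hx'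
  obtain ⟨hx1, hx2⟩ := hx'
  have hq : Q (f x.1, x.2) ≠ 0 := fun h0 => hx2 (by rw [h0, ENNReal.zero_div])
  have r1 : 0 < (p x.1).toReal := ENNReal.toReal_pos hx1 (PMF.apply_ne_top _ _)
  have r2 : 0 < (Q (f x.1, x.2)).toReal := ENNReal.toReal_pos hq (PMF.apply_ne_top _ _)
  have r3 := p.toReal_map_apply_pos f hx1
  rw [hp', ENNReal.toReal_mul, ENNReal.toReal_div, Real.logb_mul r1.ne' (div_pos r2 r3).ne',
    Real.logb_div r2.ne' r3.ne']
  congr 2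
  ring

end ent

/-! ### The Zhang–Yeung inequality -/

section ZhangYeung

variable {Ω α β γ δ : Type}

theorem toReal_ent_submod {p : PMF Ω} (hfin : ent p id ≠ ⊤) {β γ δ ε : Type} {u : Ω → β}
    {v : Ω → γ} {w : Ω → δ} {t : Ω → ε}
    (hu : ∀ ω ω', u ω = u ω' → w ω = w ω') (hv : ∀ ω ω', v ω = v ω' → w ω = w ω')
    (ht : ∀ ω ω', t ω = t ω' ↔ u ω = u ω' ∧ v ω = v ω') :
    (ent p w).toReal + (ent p t).toReal ≤ (ent p u).toReal + (ent p v).toReal := by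
  have hne {η : Type} (f : Ω → η) : ent p f ≠ ⊤ :=
    ne_top_of_le_ne_top hfin (ent_mono p fun ω ω' h => congrArg f h)
  rw [← ENNReal.toReal_add (hne _) (hne _), ← ENNReal.toReal_add (hne _) (hne _)]
  exact ENNReal.toReal_mono (ENNReal.add_ne_top.2 ⟨hne _, hne _⟩) (ent_submod p hu hv ht)

/-- The Zhang–Yeung inequality. -/
theorem zhang_yeung {p : PMF Ω} (hfin : ent p id ≠ ⊤) (A : Ω → α) (B : Ω → β) (C : Ω → γ)
    (D : Ω → δ)
    (hinj : ∀ ω ω', A ω = A ω' → B ω = B ω' → C ω = C ω' → D ω = D ω' → ω = ω')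
    {hA hB hC hD hAB hAC hBC hAD hBD hCD hABC hABD : ℝ}
    (eA : (ent p A).toReal = hA) (eB : (ent p B).toReal = hB) (eC : (ent p C).toReal = hC)
    (eAB : (ent p fun ω => (A ω, B ω)).toReal = hAB)
    (eAC : (ent p fun ω => (A ω, C ω)).toReal = hAC)
    (eBC : (ent p fun ω => (B ω, C ω)).toReal = hBC)
    (eAD : (ent p fun ω => (A ω, D ω)).toReal = hAD)
    (eBD : (ent p fun ω => (B ω, D ω)).toReal = hBD)
    (eCD : (ent p fun ω => (C ω, D ω)).toReal = hCD)
    (eABC : (ent p fun ω => (A ω, B ω, C ω)).toReal = hABC)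
    (eABD : (ent p fun ω => (A ω, B ω, D ω)).toReal = hABD) :
    hA + hB - hAB ≤ (hAC + hBC - hC - hABC) + (hAD + hBD - hD - hABD) + (hC + hD - hCD) +
      ((hAC + hBC - hC - hABC) + (hAB + hBC - hB - hABC) + (hAB + hAC - hA - hABC)) := by
  -- The new coordinate, called $R$ below, is a copy of $C$ over $(A,B)$ that is independent of
  -- $(C,D)$ given $(A,B)$.
  obtain ⟨p', hfst, hpair, hid⟩ := exists_copy p (fun ω => (A ω, B ω)) C
  have hne {η : Type} (F : Ω → η) : ent p F ≠ ⊤ :=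
    ne_top_of_le_ne_top hfin (ent_mono p fun ω ω' h => congrArg F h)
  have hfin' : ent p' id ≠ ⊤ :=
    ne_top_of_le_ne_top (ENNReal.add_ne_top.2 ⟨hne _, hfin⟩) (hid ▸ le_self_add)
  have hm {η : Type} (F : Ω → η) : ent p F = ent p' fun x => F x.1 := by
    conv_lhs => rw [← hfst]
    exact ent_map _ _ _
  -- $(A,B,R)$ has the same law as $(A,B,C)$.
  have hc {η : Type} (G : (α × β) × γ → η) :
      ent p (fun ω => G ((A ω, B ω), C ω)) = ent p' fun x => G ((A x.1, B x.1), x.2) := by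
    have h1 := ent_map p (fun ω => ((A ω, B ω), C ω)) G
    have h2 := ent_map p' (fun x => ((A x.1, B x.1), x.2)) G
    rw [hpair, h1] at h2
    exact h2
  have cR := hc Prod.snd
  have cAR := hc fun y => (y.1.1, y.2)
  have cBR := hc fun y => (y.1.2, y.2)
  have cABR := hc fun y => (y.1.1, y.1.2, y.2)
  have hjoint : ent p id = ent p' fun x => (A x.1, B x.1, C x.1, D x.1) := by
    rw [← hm fun ω => (A ω, B ω, C ω, D ω)]
    refine ent_congr p fun ω ω' => ⟨fun h => by rw [show ω = ω' from h], fun h => ?_⟩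
    simp only [Prod.mk.injEq] at h
    exact hinj ω ω' h.1 h.2.1 h.2.2.1 h.2.2.2
  have hjoint' : ent p' id = ent p' fun x => (A x.1, B x.1, C x.1, D x.1, x.2) := by
    refine ent_congr p' fun x x' => ⟨fun h => by rw [show x = x' from h], fun h => ?_⟩
    simp only [Prod.mk.injEq] at h
    exact Prod.ext (hinj _ _ h.1 h.2.1 h.2.2.1 h.2.2.2.1) h.2.2.2.2
  have hABC' : ent p (fun ω => ((A ω, B ω), C ω)) = ent p fun ω => (A ω, B ω, C ω) :=
    ent_congr p fun ω ω' => by simp only [Prod.mk.injEq, and_assoc]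
  have hid' := congrArg ENNReal.toReal hid
  rw [ENNReal.toReal_add hfin' (hne _), ENNReal.toReal_add (hne _) hfin, hABC', eAB, eABC,
    hjoint, hjoint'] at hid'
  have fR := eC
  have fAR := eAC
  have fBR := eBC
  have fABR := eABC
  rw [cR] at fR
  rw [cAR] at fAR
  rw [cBR] at fBR
  rw [cABR] at fABR
  rw [hm] at eA eB eC eAB eAC eBC eAD eBD eCD eABC eABD
  -- The ten inequalities are the nonnegativity of $I(C;D|R)$, $I(A;B|CR)$, $I(A;B|DR)$, $I(R;C|A)$,
  -- $I(R;C|B)$, $I(R;D|A)$, $I(R;D|B)$, $I(R;AB|CD)$, $I(R;D|ABC)$ and $I(R;C|ABD)$. Adding them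
  -- all, and using $H(ABCDR)=H(ABC)+H(ABCD)-H(AB)$ three times, cancels every entropy that involves
  -- $R$ together with $C$ or $D$ and leaves the claim.
  have s0 := toReal_ent_submod hfin' (u := fun x => (C x.1, x.2)) (v := fun x => (D x.1, x.2))
    (w := fun x => x.2) (t := fun x => (C x.1, D x.1, x.2))
    (by grind) (by grind) (by grind)
  have s1 := toReal_ent_submod hfin' (u := fun x => (A x.1, C x.1, x.2)) (v := fun x => (B x.1, C x.1, x.2))
    (w := fun x => (C x.1, x.2)) (t := fun x => (A x.1, B x.1, C x.1, x.2))
    (by grind) (by grind) (by grind)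
  have s2 := toReal_ent_submod hfin' (u := fun x => (A x.1, D x.1, x.2)) (v := fun x => (B x.1, D x.1, x.2))
    (w := fun x => (D x.1, x.2)) (t := fun x => (A x.1, B x.1, D x.1, x.2))
    (by grind) (by grind) (by grind)
  have s3 := toReal_ent_submod hfin' (u := fun x => (A x.1, x.2)) (v := fun x => (A x.1, C x.1))
    (w := fun x => A x.1) (t := fun x => (A x.1, C x.1, x.2))
    (by grind) (by grind) (by grind)
  have s4 := toReal_ent_submod hfin' (u := fun x => (B x.1, x.2)) (v := fun x => (B x.1, C x.1))
    (w := fun x => B x.1) (t := fun x => (B x.1, C x.1, x.2))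
    (by grind) (by grind) (by grind)
  have s5 := toReal_ent_submod hfin' (u := fun x => (A x.1, x.2)) (v := fun x => (A x.1, D x.1))
    (w := fun x => A x.1) (t := fun x => (A x.1, D x.1, x.2))
    (by grind) (by grind) (by grind)
  have s6 := toReal_ent_submod hfin' (u := fun x => (B x.1, x.2)) (v := fun x => (B x.1, D x.1))
    (w := fun x => B x.1) (t := fun x => (B x.1, D x.1, x.2))
    (by grind) (by grind) (by grind)
  have s7 := toReal_ent_submod hfin' (u := fun x => (C x.1, D x.1, x.2)) (v := fun x => (A x.1, B x.1, C x.1, D x.1))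
    (w := fun x => (C x.1, D x.1)) (t := fun x => (A x.1, B x.1, C x.1, D x.1, x.2))
    (by grind) (by grind) (by grind)
  have s8 := toReal_ent_submod hfin' (u := fun x => (A x.1, B x.1, C x.1, x.2)) (v := fun x => (A x.1, B x.1, C x.1, D x.1))
    (w := fun x => (A x.1, B x.1, C x.1)) (t := fun x => (A x.1, B x.1, C x.1, D x.1, x.2))
    (by grind) (by grind) (by grind)
  have s9 := toReal_ent_submod hfin' (u := fun x => (A x.1, B x.1, D x.1, x.2)) (v := fun x => (A x.1, B x.1, C x.1, D x.1))
    (w := fun x => (A x.1, B x.1, D x.1)) (t := fun x => (A x.1, B x.1, C x.1, D x.1, x.2))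
    (by grind) (by grind) (by grind)
  simp only [eA, eB, eAC, eBC, eAD, eBD, eCD, eABC, eABD, fR, fAR, fBR] at s0 s1 s2 s3 s4 s5 s6 s7 s8 s9
  linarith

end ZhangYeung

/-! ### Inequalities for the closure of the entropy region -/

theorem formalH_eq_toReal_ent {x : EntropySpace15} {α : Fin 4 → Type} {p : PMF (∀ i, α i)}
    (hp : ∀ S : {S : Finset (Fin 4) // S.Nonempty}, HasEntropy (marginal p S.1) (x S))
    {S : Finset (Fin 4)} (hS : S.Nonempty) {η : Type} {F : (∀ i, α i) → η}
    (hF : ∀ a b, F a = F b ↔ ∀ i ∈ S, a i = b i) : (ent p F).toReal = formalH x S := by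
  obtain ⟨h0, h1⟩ := hasEntropy_map_iff.1 (hp ⟨S, hS⟩)
  rw [formalH, dif_pos hS, ← ENNReal.toReal_ofReal h0, ← h1]
  refine congrArg _ (ent_congr p fun a b => ?_)
  rw [hF, funext_iff, Subtype.forall]

theorem zhang_yeung_of_mem_entropyRegion {x : EntropySpace15} (hx : x ∈ entropyRegion)
    (σ : Equiv.Perm (Fin 4)) :
    formalI x {σ 0} {σ 1} ∅ ≤
      formalI x {σ 0} {σ 1} {σ 2} + formalI x {σ 0} {σ 1} {σ 3} + formalI x {σ 2} {σ 3} ∅ +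
      (formalI x {σ 0} {σ 1} {σ 2} + formalI x {σ 0} {σ 2} {σ 1} + formalI x {σ 1} {σ 2} {σ 0}) := by
  obtain ⟨α, p, hp⟩ := hx
  have hcov (i : Fin 4) : i = σ 0 ∨ i = σ 1 ∨ i = σ 2 ∨ i = σ 3 := by
    obtain ⟨j, rfl⟩ := σ.surjective i
    fin_cases j <;> simp
  have hfin : ent p id ≠ ⊤ := by
    obtain ⟨-, h1⟩ := hasEntropy_map_iff.1 (hp ⟨Finset.univ, Finset.univ_nonempty⟩)
    rw [ent_congr p (f := id) (g := fun a (i : (Finset.univ : Finset (Fin 4))) => a i), h1]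
    · exact ENNReal.ofReal_ne_top
    · intro a b
      simp [funext_iff]
  have key1 (i) := formalH_eq_toReal_ent hp (S := {i}) (F := fun a => a i) (by simp)
    (by simp)
  have key2 (i j) := formalH_eq_toReal_ent hp (S := {i} ∪ {j}) (F := fun a => (a i, a j))
    (by simp) (by simp)
  have key3 (i j k) := formalH_eq_toReal_ent hp (S := {i} ∪ {j} ∪ {k})
    (F := fun a => (a i, a j, a k)) (by simp) (by simp)
  have h := zhang_yeung hfin (fun a => a (σ 0)) (fun a => a (σ 1)) (fun a => a (σ 2))
    (fun a => a (σ 3)) (hD := formalH x {σ 3})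
    (fun a b h0 h1 h2 h3 => funext fun i => by
      rcases hcov i with rfl | rfl | rfl | rfl <;> assumption)
    (key1 _) (key1 _) (key1 _) (key2 _ _) (key2 _ _) (key2 _ _) (key2 _ _) (key2 _ _) (key2 _ _)
    (key3 _ _ _) (key3 _ _ _)
  have h0 : formalH x ∅ = 0 := by simp [formalH]
  simp only [formalI, Finset.union_empty, h0]
  rw [Finset.union_right_comm {σ 0} {σ 2} {σ 1},
    Finset.union_comm ({σ 1} ∪ {σ 2}) {σ 0}, ← Finset.union_assoc {σ 0} {σ 1} {σ 2},
    Finset.union_comm {σ 2} {σ 1}, Finset.union_comm {σ 1} {σ 0}, Finset.union_comm {σ 2} {σ 0}]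
  linarith

theorem continuous_formalH (S : Finset (Fin 4)) : Continuous fun x => formalH x S := by
  unfold formalH
  split_ifs
  · exact continuous_apply _
  · exact continuous_const

theorem continuous_formalI (S T U : Finset (Fin 4)) : Continuous fun x => formalI x S T U :=
  (((continuous_formalH _).add (continuous_formalH _)).sub (continuous_formalH _)).sub
    (continuous_formalH _)

theorem zhang_yeung_of_mem_closure {x : EntropySpace15} (hx : x ∈ closure entropyRegion)
    (σ : Equiv.Perm (Fin 4)) :
    formalI x {σ 0} {σ 1} ∅ ≤
      formalI x {σ 0} {σ 1} {σ 2} + formalI x {σ 0} {σ 1} {σ 3} + formalI x {σ 2} {σ 3} ∅ +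
      (formalI x {σ 0} {σ 1} {σ 2} + formalI x {σ 0} {σ 2} {σ 1} + formalI x {σ 1} {σ 2} {σ 0}) := by
  have hc := continuous_formalI
  exact closure_minimal (t := {x | formalI x {σ 0} {σ 1} ∅ ≤
      formalI x {σ 0} {σ 1} {σ 2} + formalI x {σ 0} {σ 1} {σ 3} + formalI x {σ 2} {σ 3} ∅ +
      (formalI x {σ 0} {σ 1} {σ 2} + formalI x {σ 0} {σ 2} {σ 1} + formalI x {σ 1} {σ 2} {σ 0})})
    (fun x hx => zhang_yeung_of_mem_entropyRegion hx σ)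
    (isClosed_le (hc _ _ _) ((((hc _ _ _).add (hc _ _ _)).add (hc _ _ _)).add
      (((hc _ _ _).add (hc _ _ _)).add (hc _ _ _)))) hx

theorem ingleton_add_triple_nonneg {x : EntropySpace15} (hx : x ∈ closure entropyRegion)
    {q : ℕ × ℕ × ℕ × ℕ} (hq : q ∈ quads) {c : ℕ} (hc : c = q.2.2.1 ∨ c = q.2.2.2) :
    0 ≤ ev (ingFn q) (maskH x) + ((tripleFns q.1 q.2.1 c).map fun f => ev f (maskH x)).sum := by
  obtain ⟨σ, h0, h1, h2, h3⟩ := exists_perm_of_mem_quads q hq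
  simp only [tripleFns, List.map_cons, List.map_nil, List.sum_cons, List.sum_nil, ev_ingFn,
    ev_infoFn, bits_zero, h0, h1]
  rcases hc with rfl | rfl
  · have := zhang_yeung_of_mem_closure hx σ
    rw [h2, h3]
    linarith
  -- The Ingleton expression does not change when $C$ and $D$ are exchanged, but the added triple
  -- does.
  · have := zhang_yeung_of_mem_closure hx (Equiv.swap 2 3 |>.trans σ)
    simp only [Equiv.trans_apply, Equiv.swap_apply_left, Equiv.swap_apply_right,
      Equiv.swap_apply_of_ne_of_ne (show (0 : Fin 4) ≠ 2 by decide) (show (0 : Fin 4) ≠ 3 by decide),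
      Equiv.swap_apply_of_ne_of_ne (show (1 : Fin 4) ≠ 2 by decide) (show (1 : Fin 4) ≠ 3 by decide)]
      at this
    rw [h2, h3]
    rw [formalI_comm x {σ 3} {σ 2} ∅] at this
    linarith

/-! ### Realization of the rays by codes -/

section Code

variable {V W : Type}

/-- The distribution on blocks of `n` symbols of `V` that is uniform with probability `ε`, and
with probability `1 - ε` the block is absent. -/
noncomputable def blockPMF (V : Type) [Fintype V] [Nonempty V] (n : ℕ) (ε : ℝ) (h0 : 0 < ε)
    (h1 : ε < 1) : PMF (Option (Fin n → V)) :=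
  PMF.ofFintype
    (fun s => s.elim (ENNReal.ofReal (1 - ε)) fun _ => ENNReal.ofReal (ε / Fintype.card V ^ n)) <| by
    classical
    have hV : (0 : ℝ) < Fintype.card V := by exact_mod_cast Fintype.card_pos
    rw [Fintype.sum_option]
    simp only [Option.elim, Finset.sum_const, Finset.card_univ, Fintype.card_fun, Fintype.card_fin,
      nsmul_eq_mul]
    rw [← ENNReal.ofReal_natCast, ← ENNReal.ofReal_mul (Nat.cast_nonneg _),
      ← ENNReal.ofReal_add (by linarith) (by positivity), ENNReal.ofReal_eq_one]
    push_cast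
    field_simp
    ring

theorem card_agree {φ : Fin 4 → V → W} {S : Finset (Fin 4)} {K : ℕ}
    (hK : ∀ u, Nat.card {v // ∀ i ∈ S, φ i u = φ i v} = K) {n : ℕ} (u : Fin n → V) :
    Nat.card {v : Fin n → V // ∀ i ∈ S, φ i ∘ u = φ i ∘ v} = K ^ n := by
  have e : {v : Fin n → V // ∀ i ∈ S, φ i ∘ u = φ i ∘ v} ≃
      ∀ t : Fin n, {v // ∀ i ∈ S, φ i (u t) = φ i v} :=
    { toFun := fun v t => ⟨v.1 t, fun i hi => congrFun (v.2 i hi) t⟩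
      invFun := fun v => ⟨fun t => (v t).1, fun i hi => funext fun t => (v t).2 i hi⟩
      left_inv := fun _ => rfl
      right_inv := fun _ => rfl }
  rw [Nat.card_congr e, Nat.card_pi]
  simp [hK]

/-- Every nonempty collection of variables sees whether the block is present, which contributes the
binary entropy of `ε`. A present block is uniform on $b^{n\,r(S)}$ values, because all fibres of the
code have the same size. -/
theorem code_mem_entropyRegion [Fintype V] [Nonempty V] {φ : Fin 4 → V → W} {b : ℕ} (hb : 0 < b)
    {r : Finset (Fin 4) → ℕ}
    (hr : ∀ S u, Nat.card {v // ∀ i ∈ S, φ i u = φ i v} * b ^ r S = Fintype.card V)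
    (n : ℕ) {ε : ℝ} (h0 : 0 < ε) (h1 : ε < 1) :
    (fun S => (Real.negMulLog (1 - ε) + Real.negMulLog ε) / Real.log 2 +
      ε * n * Real.logb 2 b * r S.1 : EntropySpace15) ∈ entropyRegion := by
  classical
  have hV : (0 : ℝ) < Fintype.card V := by exact_mod_cast Fintype.card_pos
  have hb' : (1 : ℝ) ≤ b := by exact_mod_cast hb
  have hb0 : (0 : ℝ) < b := by linarith
  set src := blockPMF V n ε h0 h1
  have src_none : src none = ENNReal.ofReal (1 - ε) := rfl
  have src_some (u) : src (some u) = ENNReal.ofReal (ε / Fintype.card V ^ n) := rfl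
  refine ⟨fun _ => Option (Fin n → W), src.map fun s i => s.map fun u => φ i ∘ u, ?_⟩
  rintro ⟨S, hS⟩
  obtain ⟨i₀, hi₀⟩ := hS
  rw [marginal, PMF.map_comp, hasEntropy_map_iff]
  set F : Option (Fin n → V) → (∀ _ : S, Option (Fin n → W)) :=
    (fun a (i : S) => a i) ∘ fun s i => s.map fun u => φ i ∘ u with hF
  have hFnone (u) : F none ≠ F (some u) := fun h => by
    have := congrFun h ⟨i₀, hi₀⟩
    simp [hF] at this
  have hFsome (u v) : F (some u) = F (some v) ↔ ∀ i ∈ S, φ i ∘ u = φ i ∘ v := by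
    simp [hF, funext_iff]
  have mnone : (src.map F) (F none) = ENNReal.ofReal (1 - ε) := by
    rw [PMF.map_apply_apply, tsum_fintype, Fintype.sum_option]
    simp [hFnone, src_none]
  have msome (u) : (src.map F) (F (some u)) = ENNReal.ofReal (ε / (b ^ r S) ^ n) := by
    rw [PMF.map_apply_apply, tsum_fintype, Fintype.sum_option]
    simp only [(hFnone u).symm, if_false, zero_add, src_some, hFsome]
    rw [← Finset.sum_filter, Finset.sum_const, nsmul_eq_mul, ← Fintype.card_subtype,
      ← Nat.card_eq_fintype_card]
    have hK : ∀ u, Nat.card {v // ∀ i ∈ S, φ i u = φ i v} = Fintype.card V / b ^ r S := fun u => by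
      rw [← hr S u, Nat.mul_div_cancel _ (pow_pos hb _)]
    rw [card_agree hK, ← ENNReal.ofReal_natCast, ← ENNReal.ofReal_mul (Nat.cast_nonneg _)]
    congr 1
    obtain ⟨u₀⟩ := ‹Nonempty V›
    rw [Nat.cast_pow, Nat.cast_div ⟨_, (hr S u₀).symm.trans (mul_comm _ _)⟩
      (by push_cast; positivity)]
    push_cast
    field_simp
    rw [← mul_pow, div_mul_cancel₀ _ (by positivity)]
  have hl2 : 0 < Real.log 2 := Real.log_pos one_lt_two
  have hlog : Real.logb 2 (ε / (b ^ r S) ^ n) = Real.log ε / Real.log 2 -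
      n * (r S * Real.logb 2 b) := by
    rw [Real.logb_div h0.ne' (by positivity), Real.logb_pow, Real.logb_pow, Real.logb]
  have hent : ent src F = ENNReal.ofReal ((1 - ε) * -Real.logb 2 (1 - ε)) +
      ENNReal.ofReal (ε * -Real.logb 2 (ε / (b ^ r S) ^ n)) := by
    rw [ent, tsum_fintype, Fintype.sum_option]
    simp only [mnone, msome, src_none, src_some]
    have hN : ((Fintype.card V ^ n : ℕ) : ENNReal) *
        ENNReal.ofReal (ε / Fintype.card V ^ n) = ENNReal.ofReal ε := by
      rw [← ENNReal.ofReal_natCast, ← ENNReal.ofReal_mul (Nat.cast_nonneg _)]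
      congr 1
      push_cast
      field_simp
    rw [Finset.sum_const, Finset.card_univ, Fintype.card_fun, Fintype.card_fin, nsmul_eq_mul,
      ← mul_assoc, hN, ENNReal.toReal_ofReal (by linarith), ENNReal.toReal_ofReal (by positivity),
      ENNReal.ofReal_mul (p := 1 - ε) (by linarith), ENNReal.ofReal_mul (p := ε) h0.le]
  have n1 : 0 ≤ (1 - ε) * -Real.logb 2 (1 - ε) :=
    mul_nonneg (by linarith) (neg_nonneg.2 (Real.logb_nonpos one_lt_two (by linarith)
      (by linarith)))
  have n2 : 0 ≤ ε * -Real.logb 2 (ε / (b ^ r S) ^ n) := by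
    refine mul_nonneg h0.le (neg_nonneg.2 (Real.logb_nonpos one_lt_two (by positivity) ?_))
    exact (div_le_self h0.le (one_le_pow₀ (one_le_pow₀ hb'))).trans h1.le
  have heq : (Real.negMulLog (1 - ε) + Real.negMulLog ε) / Real.log 2 +
      ε * n * Real.logb 2 b * r S = (1 - ε) * -Real.logb 2 (1 - ε) +
      ε * -Real.logb 2 (ε / (b ^ r S) ^ n) := by
    rw [hlog, Real.negMulLog, Real.negMulLog]
    simp only [Real.logb]
    field_simp
    ring
  change 0 ≤ (Real.negMulLog (1 - ε) + Real.negMulLog ε) / Real.log 2 +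
    ε * n * Real.logb 2 b * r S ∧ ent src F = ENNReal.ofReal
      ((Real.negMulLog (1 - ε) + Real.negMulLog ε) / Real.log 2 + ε * n * Real.logb 2 b * r S)
  rw [heq, hent, ENNReal.ofReal_add n1 n2]
  exact ⟨add_nonneg n1 n2, rfl⟩

open Filter Topology in
-- With $\varepsilon=c/(n\log_2 b)$ the rank term equals $c\,r(S)$ for every positive $n$, while the
-- binary entropy of $\varepsilon$ tends to 0. An arbitrary real factor $c$ allows normalization to
-- total entropy 1.
theorem smul_rank_mem_closure_entropyRegion [Fintype V] [Nonempty V] {φ : Fin 4 → V → W} {b : ℕ} (hb : 1 < b)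
    {r : Finset (Fin 4) → ℕ}
    (hr : ∀ S u, Nat.card {v // ∀ i ∈ S, φ i u = φ i v} * b ^ r S = Fintype.card V)
    {c : ℝ} (hc : 0 < c) : (fun S => c * r S.1 : EntropySpace15) ∈ closure entropyRegion := by
  have hlb : 0 < Real.logb 2 b := Real.logb_pos one_lt_two (by exact_mod_cast hb)
  set ε : ℕ → ℝ := fun n => c / Real.logb 2 b / n with hε
  have hlim : Tendsto ε atTop (𝓝 0) := tendsto_const_div_atTop_nhds_zero_nat _
  have hpos : ∀ᶠ n in atTop, 0 < ε n := by
    filter_upwards [eventually_gt_atTop 0] with n hn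
    have : (0 : ℝ) < n := by exact_mod_cast hn
    positivity
  have hlt : ∀ᶠ n in atTop, ε n < 1 := hlim.eventually_lt_const one_pos
  refine mem_closure_of_tendsto (b := atTop) (f := fun (n : ℕ) S =>
    (Real.negMulLog (1 - ε n) + Real.negMulLog (ε n)) / Real.log 2 +
      ε n * n * Real.logb 2 b * r S.1) ?_ ?_
  · refine tendsto_pi_nhds.2 fun S => ?_
    have h1 : Tendsto (fun n => (Real.negMulLog (1 - ε n) + Real.negMulLog (ε n)) / Real.log 2)
        atTop (𝓝 0) := by
      have hcont : Continuous fun x =>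
          (Real.negMulLog (1 - x) + Real.negMulLog x) / Real.log 2 :=
        ((Real.continuous_negMulLog.comp (continuous_const.sub continuous_id)).add
          Real.continuous_negMulLog).div_const _
      have : Tendsto (fun n => (Real.negMulLog (1 - ε n) + Real.negMulLog (ε n)) / Real.log 2)
          atTop (𝓝 ((Real.negMulLog (1 - 0) + Real.negMulLog 0) / Real.log 2)) :=
        (hcont.tendsto 0).comp hlim
      simpa using this
    have h2 : Tendsto (fun n : ℕ => ε n * n * Real.logb 2 b * r S.1) atTop (𝓝 (c * r S.1)) := by
      refine tendsto_const_nhds.congr' ?_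
      filter_upwards [eventually_gt_atTop 0] with n hn
      have : (n : ℝ) ≠ 0 := by exact_mod_cast hn.ne'
      simp only [hε]
      field_simp
    simpa using h1.add h2
  · filter_upwards [hpos, hlt] with n hn0 hn1
    exact code_mem_entropyRegion (by omega) hr n hn0 hn1

end Code

/-- The value of the linear form with coefficients `c` at the vector over `ℤ/b` with index `u`. -/
def formValue (b u : ℕ) (c : ℕ × ℕ × ℕ) : ℕ :=
  (c.1 * (u % b) + c.2.1 * (u / b % b) + c.2.2 * (u / b / b % b)) % b

/-- Linear codes over `ℤ/2` and `ℤ/3` realizing `ingletonRays`: the modulus, the dimension, and the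
linear forms of each of the four variables. -/
def rayCodes : List (ℕ × ℕ × (ℕ → List (ℕ × ℕ × ℕ))) :=
  (List.range' 1 15).map (fun J => (2, 1, fun i => bif J.testBit i then [(1, 0, 0)] else [])) ++
  -- Modulus 3, since the plane over $\mathbf Z/2$ has only three pairwise independent forms and
  -- four are needed.
  [7, 11, 13, 14, 15].map (fun J => (3, 2, fun i => bif J.testBit i then
    [[(1, 0, 0), (0, 1, 0), (1, 1, 0), (1, 2, 0)].getD i 0] else [])) ++
  [(2, 3, fun i => [[(1, 0, 0), (0, 1, 0), (0, 0, 1), (1, 1, 1)].getD i 0])] ++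
  quads.map (fun q => (2, 2, fun i =>
    [bif q.2.2.1.testBit i then (0, 1, 0) else bif q.2.2.2.testBit i then (1, 1, 0)
      else (1, 0, 0)])) ++
  (List.range 4).flatMap fun a => [
    (3, 2, fun i => bif i == a then [(1, 0, 0), (0, 1, 0)] else
      [[(1, 0, 0), (0, 1, 0), (1, 1, 0), (1, 2, 0)].getD i 0]),
    -- Over $\mathbf Z/2$ the two forms of variable `a` span the forms of even weight, while the
    -- other variables have forms of odd weight; so `a` together with any other variable has rank 3.
    (2, 3, fun i => bif i == a then [(1, 1, 0), (0, 1, 1)] else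
      [[(1, 0, 0), (0, 1, 0), (0, 0, 1), (1, 1, 1)].getD i 0])]

/-- Whether the code realizes a multiple of the rank function `r`. -/
def codeValid (C : ℕ × ℕ × (ℕ → List (ℕ × ℕ × ℕ))) (r : ℕ → ℕ) : Bool :=
  Nat.blt 1 C.1 && (List.range 16).all fun S => (List.range (C.1 ^ C.2.1)).all fun u =>
    Nat.beq ((List.range (C.1 ^ C.2.1)).countP (fun v => (List.range 4).all fun i =>
      !S.testBit i || (C.2.2 i).all fun c => Nat.beq (formValue C.1 u c) (formValue C.1 v c)) *
      C.1 ^ r S) (C.1 ^ C.2.1)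

theorem codeValid_rayCodes :
    ((List.zip rayCodes ingletonRays).all fun t => codeValid t.1 t.2) = true := by
  decide +kernel

theorem withTotalOne_rayPoint_mem_closure {r : ℕ → ℕ} (hr : r ∈ ingletonRays) :
    withTotalOne (rayPoint r) ∈ closure entropyRegion := by
  obtain ⟨C, hC⟩ : ∃ C, codeValid C r = true := by
    obtain ⟨i, hi, rfl⟩ := List.getElem_of_mem hr
    have hi' : i < (List.zip rayCodes ingletonRays).length := by
      rw [List.length_zip]
      exact lt_min (lt_of_lt_of_eq hi (by decide +kernel)) hi
    have := List.all_eq_true.1 codeValid_rayCodes _ (List.getElem_mem hi')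
    rw [List.getElem_zip] at this
    exact ⟨_, this⟩
  obtain ⟨b, k, forms⟩ := C
  simp only [codeValid, Bool.and_eq_true, List.all_eq_true, List.mem_range, Nat.beq_eq,
    Nat.blt_eq] at hC
  obtain ⟨hb, hC⟩ := hC
  have hpoly := isPolymatroid_ingletonRays r hr
  simp only [isPolymatroid, Bool.and_eq_true, beq_iff_eq, bne_iff_ne] at hpoly
  obtain ⟨⟨r0, r15⟩, -⟩ := hpoly
  have : NeZero (b ^ k) := ⟨(pow_pos (by omega) _).ne'⟩
  -- Vectors over $\mathbf Z/b$ are encoded by their base-`b` numerals; the factor `(r 15)⁻¹`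
  -- normalizes the total entropy.
  have key := smul_rank_mem_closure_entropyRegion (V := Fin (b ^ k)) (W := List ℕ)
    (φ := fun i u => (forms i).map (formValue b u)) hb (r := fun S => r (maskOf S)) ?_
    (c := (r 15 : ℝ)⁻¹) (by positivity)
  · convert key using 1
    funext S
    rw [withTotalOne_apply_eq, maskH_rayPoint r0 r15 (maskOf_lt _), div_eq_inv_mul]
  · intro S u
    have h := hC (maskOf S) (maskOf_lt S) u u.2
    rw [Fintype.card_fin]
    refine Eq.trans (congrArg (· * _) ?_) h
    have hbit : ∀ i : Fin 4, (maskOf S).testBit i = true ↔ i ∈ S := by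
      intro i
      conv_rhs => rw [← bits_maskOf S]
      simp [bits]
    set P : ℕ → Bool := fun v => (List.range 4).all fun i => !(maskOf S).testBit i ||
      (forms i).all fun c => Nat.beq (formValue b u c) (formValue b v c) with hP
    have hPiff (v : ℕ) : P v = true ↔
        ∀ i ∈ S, (forms i).map (formValue b u) = (forms i).map (formValue b v) := by
      simp only [hP, List.all_eq_true, List.mem_range, Bool.or_eq_true, Bool.not_eq_true',
        Nat.beq_eq, List.map_inj_left, ← hbit]
      constructor
      · intro h i hi
        exact (h i i.2).resolve_left (by simp [hi])
      · intro h i hi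
        rcases hb : (maskOf S).testBit i with _ | _
        · exact Or.inl rfl
        · exact Or.inr (h ⟨i, hi⟩ hb)
    have hcount : List.countP P (List.range (b ^ k)) =
        ((Finset.range (b ^ k)).filter fun v => P v = true).card := by
      change _ = ((List.range (b ^ k)).filter fun v => decide (P v = true)).length
      simp [List.countP_eq_length_filter]
    rw [hcount, ← Fintype.card_coe, ← Nat.card_eq_fintype_card]
    refine Nat.card_congr
      { toFun := fun v => ⟨v.1, Finset.mem_filter.2 ⟨Finset.mem_range.2 v.1.2, (hPiff _).2 v.2⟩⟩
        invFun := fun m => ⟨⟨m.1, Finset.mem_range.1 (Finset.mem_filter.1 m.2).1⟩,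
          (hPiff _).1 (Finset.mem_filter.1 m.2).2⟩
        left_inv := fun _ => rfl
        right_inv := fun _ => rfl }

/-! ### The main theorem -/

theorem convex_ingletonCone : Convex ℝ (normalized ingletonCone) := by
  intro y hy z hz a b ha hb hab
  have hH (S) : formalH (withTotalOne (a • y + b • z)) S =
      a * formalH (withTotalOne y) S + b * formalH (withTotalOne z) S := by
    unfold formalH withTotalOne
    split_ifs <;> simp [hab]
  have hI (S T U) : formalI (withTotalOne (a • y + b • z)) S T U =
      a * formalI (withTotalOne y) S T U + b * formalI (withTotalOne z) S T U := by
    simp only [formalI, hH]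
    ring
  refine ⟨fun S T U => ?_, fun σ => ?_⟩
  · rw [hI]
    exact add_nonneg (mul_nonneg ha (hy.1 S T U)) (mul_nonneg hb (hz.1 S T U))
  · simp only [hI]
    have h1 := mul_le_mul_of_nonneg_left (hy.2 σ) ha
    have h2 := mul_le_mul_of_nonneg_left (hz.2 σ) hb
    linarith

theorem theorem11 :
    core 1 (normalized (closure entropyRegion)) (normalized shannonCone) =
      normalized ingletonCone := by
  refine Set.Subset.antisymm (convexHull_min (fun y hy => ?_) convex_ingletonCone) fun y hy => ?_
  · exact mem_ingletonCone_of_mem_skeleton hy.2 fun q hq c hc =>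
      ingleton_add_triple_nonneg hy.1 hq hc
  · obtain ⟨w, hw, hw1, rfl⟩ := exists_convex_comb_of_mem_ingletonCone hy
    refine (convex_convexHull ℝ _).sum_mem (fun i _ => hw i) hw1 fun i _ => ?_
    have hi := List.get_mem ingletonRays i
    exact subset_convexHull ℝ _
      ⟨withTotalOne_rayPoint_mem_closure hi, rayPoint_mem_skeleton_of_mem hi⟩
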